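/- **Voronoi Cell Decomposition Theorem.** Let $S\subseteq\mathbb R^2$ be a finite non-empty set no four of whose points lie on a common circle. The Delaunay triangulation $D$ of $S$ consists of all non-degenerate triangles spanned by three points of $S$ such that no point of $S$ lies strictly inside the circumcircle of the triangle. For an acute triangle $\Delta$ put $V(\Delta)=\int_\Delta \min_{v}|x-v|^2\,dx$, where $v$ ranges over the three vertices of $\Delta$; for every other triangle put $V(\Delta)=\frac{\operatorname{area}(\Delta)}{12}(a^2+b^2+c^2-4R^2)$, where $a,b,c$ are the side lengths and $R$ is the circumradius of $\Delta$. Let $V(D)=\sum_{\Delta\in D}V(\Delta)$. By a vertex of $\operatorname{conv} S$ we mean a point of $S$ on the boundary of $\operatorname{conv} S$ (these are the extreme points if no point of $S$ lies in the relative interior of a side of the hull). A vertex $v$ is visible from $x\notin\operatorname{conv} S$ if the segment from $x$ to $v$ meets $\operatorname{conv} S$ only in $v$. Let $N_S(x)$ be a point of $S$ nearest to $x$, and, for $x\notin\operatorname{conv}S$, let $NV_S(x)$ be a visible vertex of $\operatorname{conv} S$ nearest to $x$ (such vertices exist); for $x\in\operatorname{conv} S$ set $|x-NV_S(x)|^2=0$.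 Then the function $x\mapsto |x-N_S(x)|^2-|x-NV_S(x)|^2$ is integrable on $\mathbb R^2$ and $$V(D)=\int_{\mathbb R^2}\bigl(|x-N_S(x)|^2-|x-NV_S(x)|^2\bigr)\,dx .$$ If, moreover, for every triangle of $D$ and every edge of it contained in the boundary of $\operatorname{conv} S$, the angle of the triangle opposite to that edge is acute, then $$V(D)=\int_{\operatorname{conv} S}|x-N_S(x)|^2\,dx .$$ -/

import Mathlib

open MeasureTheory EuclideanGeometry

noncomputable section

namespace VoronoiFunctional

/-- The Euclidean plane `ℝ²`, with its Euclidean distance and Lebesgue measure. -/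
abbrev Plane : Type := EuclideanSpace ℝ (Fin 2)

/-- The convex hull of the vertices of a triangle. -/
def body (T : Affine.Triangle ℝ Plane) : Set Plane :=
  convexHull ℝ (Set.range T.points)

/-- The Voronoi functional of a (non-degenerate) triangle `Δ`.  If `Δ` is acute, it is the integral
over `Δ` of the squared distance to the nearest of the three vertices (`Metric.infDist` to the
vertex set).  Otherwise it is `area(Δ) / 12 * (a² + b² + c² - 4 R²)`, where `a`, `b`, `c` are the
side lengths and `R` is the circumradius. -/
def voronoiTriangle (T : Affine.Triangle ℝ Plane) : ℝ :=
  open Classical in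
  if T.AcuteAngled then
    ∫ x in body T, Metric.infDist x (Set.range T.points) ^ 2
  else
    volume.real (body T) / 12 *
      (dist (T.points 1) (T.points 2) ^ 2 + dist (T.points 2) (T.points 0) ^ 2
        + dist (T.points 0) (T.points 1) ^ 2 - 4 * T.circumradius ^ 2)

/-- The Voronoi functional of a triangle does not depend on the order of its vertices. -/
theorem voronoiTriangle_eq_of_range_eq (T T' : Affine.Triangle ℝ Plane)
    (h : Set.range T.points = Set.range T'.points) : voronoiTriangle T = voronoiTriangle T' := by
  have hex : ∀ i, ∃ j, T.points j = T'.points i := fun i => by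
    have : T'.points i ∈ Set.range T.points := h ▸ Set.mem_range_self i
    exact this
  choose f hf using hex
  have hinj : Function.Injective f := fun i j hij => by
    apply T'.independent.injective
    rw [← hf i, ← hf j, hij]
  let e : Fin 3 ≃ Fin 3 := Equiv.ofBijective f (Finite.injective_iff_bijective.mp hinj)
  have hT' : T' = T.reindex e.symm := by
    ext1 i
    simp only [Affine.Simplex.reindex_points, Function.comp_apply, Equiv.symm_symm]
    exact (hf i).symm
  have hacute : T'.AcuteAngled ↔ T.AcuteAngled := by
    rw [hT']; exact Affine.Simplex.acuteAngled_reindex_iff _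
  have hR : T'.circumradius = T.circumradius := by
    rw [hT']; exact Affine.Simplex.circumradius_reindex _ _
  have hsum : ∀ U : Affine.Triangle ℝ Plane,
      dist (U.points 1) (U.points 2) ^ 2 + dist (U.points 2) (U.points 0) ^ 2
        + dist (U.points 0) (U.points 1) ^ 2
      = (∑ i : Fin 3, ∑ j : Fin 3, dist (U.points i) (U.points j) ^ 2) / 2 := fun U => by
    simp only [Fin.sum_univ_three, dist_self]
    rw [dist_comm (U.points 1) (U.points 0), dist_comm (U.points 2) (U.points 1),
      dist_comm (U.points 2) (U.points 0)]
    ring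
  have hdbl : (∑ i : Fin 3, ∑ j : Fin 3, dist (T'.points i) (T'.points j) ^ 2)
      = ∑ i : Fin 3, ∑ j : Fin 3, dist (T.points i) (T.points j) ^ 2 := by
    have hpt : ∀ i, T'.points i = T.points (e i) := fun i => (hf i).symm
    simp only [hpt]
    rw [← Equiv.sum_comp e (fun i => ∑ j, dist (T.points i) (T.points j) ^ 2)]
    refine Finset.sum_congr rfl fun i _ => ?_
    exact Equiv.sum_comp e (fun j => dist (T.points (e i)) (T.points j) ^ 2)
  unfold voronoiTriangle body
  rw [hsum T, hsum T', hdbl, hR, h]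
  by_cases ha : T.AcuteAngled
  · rw [if_pos ha, if_pos (hacute.mpr ha)]
  · rw [if_neg ha, if_neg (fun h' => ha (hacute.mp h'))]

/-- The Voronoi functional of the triangle with vertex set `t`
(`0` if `t` is not the vertex set of a triangle). -/
def voronoiVertexSet (t : Finset Plane) : ℝ :=
  open Classical in
  if h : ∃ T : Affine.Triangle ℝ Plane, Set.range T.points = (t : Set Plane) then
    voronoiTriangle h.choose
  else 0

/-- `T` is a Delaunay triangle of `S`: its vertices belong to `S`, and no point of `S` is enclosed
by its circumcircle. -/
def IsDelaunay (S : Finset Plane) (T : Affine.Triangle ℝ Plane) : Prop :=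
  (∀ i, T.points i ∈ S) ∧ ∀ p ∈ S, T.circumradius ≤ dist p T.circumcenter

/-- The triangles of the Delaunay triangulation of `S`, each given by its vertex set. -/
def delaunay (S : Finset Plane) : Finset (Finset Plane) :=
  open Classical in
  S.powerset.filter fun t =>
    ∃ T : Affine.Triangle ℝ Plane, IsDelaunay S T ∧ Set.range T.points = (t : Set Plane)

/-- The Voronoi functional of a triangulation is the sum over its triangles. -/
def voronoi (K : Finset (Finset Plane)) : ℝ :=
  ∑ t ∈ K, voronoiVertexSet t

/-- General position: no four points of `S` lie on a common circle. -/
def GeneralPosition (S : Finset Plane) : Prop :=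
  ∀ t ⊆ S, t.card = 4 → ¬ Cospherical (t : Set Plane)

/-- The convex hull of `S`. -/
def hull (S : Finset Plane) : Set Plane :=
  convexHull ℝ (S : Set Plane)

/-- The vertices of `conv S`: the points of `S` on the boundary of `conv S`.  Points of `S` in the
relative interior of a side of the hull count as vertices (they are vertices of the boundary of
every triangulation of `S`); if there are none, these are exactly the extreme points. -/
def hullVertices (S : Finset Plane) : Set Plane :=
  {v | v ∈ S ∧ v ∈ frontier (hull S)}

/-- The vertices of `conv S` visible from `x`: those `v` for which the segment from `x` to `v`
meets `conv S` only in `v`. -/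
def visibleVertices (S : Finset Plane) (x : Plane) : Set Plane :=
  {v | v ∈ hullVertices S ∧ segment ℝ x v ∩ hull S = {v}}

/-- `p` is a nearest point to `x` in the set `A`. -/
def IsNearest (A : Set Plane) (x p : Plane) : Prop :=
  p ∈ A ∧ ∀ q ∈ A, dist x p ≤ dist x q

/-- In the Delaunay triangulation of `S`, all angles opposite to edges of the convex hull are
acute. -/
def HullOppositeAnglesAcute (S : Finset Plane) : Prop :=
  ∀ T : Affine.Triangle ℝ Plane, IsDelaunay S T →
    ∀ i j k : Fin 3, i ≠ j → i ≠ k → j ≠ k →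
      segment ℝ (T.points i) (T.points j) ⊆ frontier (hull S) →
        ∠ (T.points i) (T.points k) (T.points j) < Real.pi / 2

open Classical in
/-- The function `x ↦ |x - N(x)|² - |x - NV(x)|²`, where the second term is `0` for `x` in
`conv S`. -/
def cellIntegrand (S : Finset Plane) (N NV : Plane → Plane) (x : Plane) : ℝ :=
  dist x (N x) ^ 2 - if x ∈ hull S then 0 else dist x (NV x) ^ 2

end VoronoiFunctional

end

/-!
Split the Voronoi cell of each `v ∈ S` by the rays from `v`: such a ray leaves the cell through the
bisector of `v` and some `w` (the exit cell of `v`, `w`), or never, in which case it lies in the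
normal cone of `conv S` at `v`. For `x ∉ conv S`, the nearest visible vertex is `v` if `x` projects
to `v`, and otherwise the nearer endpoint of the hull edge onto which `x` projects (the face cell).
The normal cones therefore cancel, and almost everywhere the integrand is the sum over ordered pairs
`(v, w)` of `|x - v|² (1[exit cell of v, w] - 1[face cell of v, w])`.

Fix `(v, w)` and describe a ray from `v` by the point where it meets the bisector of `v` and `w`.
The exit cell is then an interval of parameters, the centres of empty circles through `v` and `w`.
Its finite endpoints are circumcentres of Delaunay triangles with edge `v w`, and it is unbounded
exactly if `v w` is a hull edge, where the face cell removes the unbounded part. So the term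
of `(v, w)` is a signed sum of right triangles with vertices `v`, the midpoint of `v w` and a
circumcentre. Collected by Delaunay triangles, these are three signed isosceles triangles with apex
at the circumcentre, whose integrals add up to `V(Δ)`: by direct computation if `Δ` is not acute,
and by the integral formula for `S` the set of the three vertices of `Δ` if it is acute.
-/

noncomputable section

namespace VoronoiFunctional

open Set

section InnerProductSpace

variable {E : Type*} [NormedAddCommGroup E] [InnerProductSpace ℝ E]

/-- The inner product of the vectors from `o` to `p` and to `q`. -/
def innerAt (o p q : E) : ℝ := inner ℝ (p - o) (q - o)

theorem innerAt_comm (o p q : E) : innerAt o p q = innerAt o q p := real_inner_comm _ _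

@[simp]
theorem innerAt_base_left (o q : E) : innerAt o o q = 0 := by simp [innerAt]

@[simp]
theorem innerAt_base_right (o p : E) : innerAt o p o = 0 := by simp [innerAt]

theorem innerAt_self (o p : E) : innerAt o p p = dist p o ^ 2 := by
  rw [innerAt, real_inner_self_eq_norm_sq, dist_eq_norm]

theorem innerAt_self_nonneg (o p : E) : 0 ≤ innerAt o p p := real_inner_self_nonneg

theorem innerAt_self_pos {o p : E} : 0 < innerAt o p p ↔ p ≠ o := by
  rw [innerAt, real_inner_self_pos, sub_ne_zero]

theorem eq_of_innerAt_self_nonpos {o p : E} (h : innerAt o p p ≤ 0) : p = o := by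
  rwa [innerAt, real_inner_self_nonpos, sub_eq_zero] at h

theorem innerAt_self_eq_add (o p q : E) : innerAt o p p = innerAt o p q + innerAt p q o := by
  rw [innerAt_comm p, innerAt, innerAt, innerAt, ← neg_sub p o, inner_neg_left, ← sub_eq_add_neg,
    ← inner_sub_right, sub_sub_sub_cancel_left]

theorem innerAt_eq_change_base (o v p q : E) :
    innerAt v p q = innerAt o p q - innerAt o p v - innerAt o v q + innerAt o v v := by
  simp only [innerAt, ← sub_sub_sub_cancel_right _ v o, inner_sub_left, inner_sub_right]
  ring

theorem dist_sq_sub_dist_sq (x v p : E) :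
    dist x p ^ 2 - dist x v ^ 2 = innerAt v p p - 2 * innerAt v p x := by
  rw [← innerAt_self, ← innerAt_self, innerAt_eq_change_base v p, innerAt_comm v x p]
  ring

theorem dist_le_dist_iff_innerAt {x v p : E} :
    dist x v ≤ dist x p ↔ 2 * innerAt v p x ≤ innerAt v p p := by
  rw [← sq_le_sq₀ dist_nonneg dist_nonneg, ← sub_nonneg, dist_sq_sub_dist_sq, sub_nonneg]

theorem dist_lt_dist_iff_innerAt {x v p : E} :
    dist x v < dist x p ↔ 2 * innerAt v p x < innerAt v p p := by
  rw [← sq_lt_sq₀ dist_nonneg dist_nonneg, ← sub_pos, dist_sq_sub_dist_sq, sub_pos]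

/-- The closed Voronoi cell of `v`: the points which are no further from `v` than from any point
of `s`. -/
def voronoiCell (s : Set E) (v : E) : Set E := {x | ∀ p ∈ s, dist x v ≤ dist x p}

/-- The cone, with apex `v`, of the outer normals at `v` to the convex hull of `s`. -/
def normalCone (s : Set E) (v : E) : Set E := {x | ∀ p ∈ s, innerAt v p x ≤ 0}

/-- The open strip of the points whose orthogonal projection to the line `vw` lies on the half of
the segment `[v, w]` adjacent to `v`. -/
def nearStrip (v w : E) : Set E := {x | 0 < innerAt v w x ∧ 2 * innerAt v w x < innerAt v w w}

/-- The points `x` of the Voronoi cell of `v` such that the ray from `v` through `x` leaves the cell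
through the bisector of `v` and `w`.  That ray meets the bisector of `v` and `p` at the multiple
`innerAt v p p / (2 * innerAt v p x)` of `x - v`; the inequality compares these multiples. -/
def exitCell (s : Set E) (v w : E) : Set E :=
  {x ∈ nearStrip v w | ∀ p ∈ s, innerAt v p x * innerAt v w w ≤ innerAt v w x * innerAt v p p}

/-- The position of `x` is general with respect to `s`: its distances to the points of `s` differ,
and every ray from a point `v` of `s` through `x` meets the bisectors of `v` and the other points of
`s` one at a time. -/
structure Generic (s : Set E) (x : E) : Prop where
  injOn_dist : InjOn (dist x) s
  bisectors_ne : ∀ v ∈ s, ∀ w ∈ s, ∀ p ∈ s, w ≠ v → p ≠ v → p ≠ w →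
    innerAt v p x * innerAt v w w ≠ innerAt v w x * innerAt v p p

section Cells

variable {s : Set E} {v w x : E}

theorem normalCone_subset_voronoiCell : normalCone s v ⊆ voronoiCell s v := fun x hx p hp =>
  dist_le_dist_iff_innerAt.mpr (by linarith [hx p hp, innerAt_self_nonneg v p])

theorem nearStrip_self : nearStrip v v = ∅ := by simp [nearStrip]

theorem exitCell_subset_voronoiCell : exitCell s v w ⊆ voronoiCell s v := fun x hx p hp => by
  obtain ⟨⟨hpos, hnear⟩, hle⟩ := hx
  have hw : 0 < innerAt v w w := by linarith
  refine dist_le_dist_iff_innerAt.mpr (le_of_mul_le_mul_right ?_ hw)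
  calc 2 * innerAt v p x * innerAt v w w = 2 * (innerAt v p x * innerAt v w w) := by ring
    _ ≤ 2 * (innerAt v w x * innerAt v p p) := mul_le_mul_of_nonneg_left (hle p hp) two_pos.le
    _ = (2 * innerAt v w x) * innerAt v p p := by ring
    _ ≤ innerAt v w w * innerAt v p p := by gcongr; exact innerAt_self_nonneg v p
    _ = innerAt v p p * innerAt v w w := mul_comm _ _

theorem notMem_normalCone_of_mem_exitCell (hw : w ∈ s) (hx : x ∈ exitCell s v w) :
    x ∉ normalCone s v := fun h => (h w hw).not_gt hx.1.1

theorem Generic.eq_of_mem_exitCell {p : E} (hx : Generic s x) (hv : v ∈ s) (hw : w ∈ s)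
    (hp : p ∈ s) (hxw : x ∈ exitCell s v w) (hxp : x ∈ exitCell s v p) : p = w := by
  have ne_of_mem {u : E} (hxu : x ∈ exitCell s v u) : u ≠ v := by
    rintro rfl
    exact (nearStrip_self (v := u)).subset hxu.1
  by_contra hpw
  exact hx.bisectors_ne v hv w hw p hp (ne_of_mem hxw) (ne_of_mem hxp) hpw
    (le_antisymm (hxw.2 p hp) (hxp.2 w hw))

end Cells

theorem Generic.exists_mem_exitCell {S : Finset E} {v x : E} (hx : Generic (S : Set E) x)
    (hv : v ∈ S) (hcell : x ∈ voronoiCell (S : Set E) v) (hcone : x ∉ normalCone (S : Set E) v) :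
    ∃ w ∈ S, x ∈ exitCell (S : Set E) v w := by
  classical
  obtain ⟨p₀, hp₀, hpos⟩ : ∃ p ∈ S, 0 < innerAt v p x := by
    simpa only [normalCone, mem_ofPred_eq, Finset.mem_coe, not_forall, not_le, exists_prop]
      using hcone
  have hp₀v : p₀ ≠ v := by
    rintro rfl
    simp at hpos
  obtain ⟨w, hw, hmax⟩ := (S.erase v).exists_max_image (fun p => innerAt v p x / innerAt v p p)
    ⟨p₀, Finset.mem_erase.mpr ⟨hp₀v, hp₀⟩⟩
  obtain ⟨hwv, hwS⟩ := Finset.mem_erase.mp hw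
  have hww : 0 < innerAt v w w := innerAt_self_pos.mpr hwv
  have hle : ∀ p ∈ S, innerAt v p x * innerAt v w w ≤ innerAt v w x * innerAt v p p := by
    intro p hp
    obtain rfl | hpv := eq_or_ne p v
    · simp
    · exact (div_le_div_iff₀ (innerAt_self_pos.mpr hpv) hww).mp
        (hmax p (Finset.mem_erase.mpr ⟨hpv, hp⟩))
  have hwx : 0 < innerAt v w x :=
    pos_of_mul_pos_left ((mul_pos hpos hww).trans_le (hle p₀ hp₀)) (innerAt_self_nonneg v p₀)
  have hne : dist x v ≠ dist x w := fun h => hwv (hx.injOn_dist hv hwS h).symm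
  exact ⟨w, hwS, ⟨hwx, dist_lt_dist_iff_innerAt.mp ((hcell w hwS).lt_of_ne hne)⟩, hle⟩

theorem Generic.sum_indicator_exitCell {S : Finset E} {v x : E} (hx : Generic (S : Set E) x)
    (hv : v ∈ S) :
    ∑ w ∈ S, (exitCell (S : Set E) v w).indicator 1 x
      = (voronoiCell (S : Set E) v).indicator (1 : E → ℝ) x
        - (normalCone (S : Set E) v).indicator 1 x := by
  rw [← Pi.sub_apply, ← indicator_sdiff normalCone_subset_voronoiCell]
  by_cases hmem : x ∈ voronoiCell (S : Set E) v \ normalCone (S : Set E) v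
  · obtain ⟨w, hw, hxw⟩ := hx.exists_mem_exitCell hv hmem.1 hmem.2
    rw [indicator_of_mem hmem, Finset.sum_eq_single_of_mem w hw, indicator_of_mem hxw]
    exact fun p hp hpw => indicator_of_notMem
      (fun hxp => hpw (hx.eq_of_mem_exitCell hv hw hp hxw hxp)) _
  · rw [indicator_of_notMem hmem]
    exact Finset.sum_eq_zero fun w hw => indicator_of_notMem (fun hxw => hmem
      ⟨exitCell_subset_voronoiCell hxw, notMem_normalCone_of_mem_exitCell hw hxw⟩) _

theorem Generic.sum_dist_sq_mul_indicator_voronoiCell {S : Finset E} {n x : E}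
    (hx : Generic (S : Set E) x) (hn : n ∈ S) (hxn : x ∈ voronoiCell (S : Set E) n) :
    ∑ v ∈ S, dist x v ^ 2 * (voronoiCell (S : Set E) v).indicator 1 x = dist x n ^ 2 := by
  rw [Finset.sum_eq_single_of_mem n hn, indicator_of_mem hxn, Pi.one_apply, mul_one]
  intro v hv hvn
  rw [indicator_of_notMem, mul_zero]
  exact fun hxv => hvn (hx.injOn_dist hv hn (le_antisymm (hxv n hn) (hxn v hv)))

section Measure

variable [FiniteDimensional ℝ E] [MeasurableSpace E] [BorelSpace E]
  (μ : Measure E) [μ.IsAddHaarMeasure]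

theorem ae_inner_sub_ne {a : E} (ha : a ≠ 0) (o : E) (k : ℝ) :
    ∀ᵐ x ∂μ, inner ℝ a (x - o) ≠ k := by
  obtain ⟨x₀, hx₀⟩ | hempty := (em (∃ x, inner ℝ a (x - o) = k)).imp_right not_exists.mp
  · let H := AffineSubspace.mk' x₀ (LinearMap.ker (innerₛₗ ℝ a))
    have mem_H (x : E) : x ∈ H ↔ inner ℝ a (x - o) = k := by
      rw [AffineSubspace.mem_mk', LinearMap.mem_ker, innerₛₗ_apply_apply, vsub_eq_sub,
        ← sub_sub_sub_cancel_right x x₀ o, inner_sub_right, hx₀, sub_eq_zero]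
    have hH : H ≠ ⊤ := by
      intro htop
      have hdir : a ∈ H.direction := by simp [htop]
      rw [AffineSubspace.direction_mk', LinearMap.mem_ker, innerₛₗ_apply_apply] at hdir
      exact ha (inner_self_eq_zero.mp hdir)
    filter_upwards [measure_eq_zero_iff_ae_notMem.mp (μ.addHaar_affineSubspace H hH)] with x hx
    exact fun h => hx ((mem_H x).mpr h)
  · exact Filter.Eventually.of_forall hempty

theorem ae_bisectors_ne {v w p : E} (hw : w ≠ v) (hp : p ≠ v) (hpw : p ≠ w) :
    ∀ᵐ x ∂μ, innerAt v p x * innerAt v w w ≠ innerAt v w x * innerAt v p p := by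
  have hw' : 0 < innerAt v w w := innerAt_self_pos.mpr hw
  have hp' : 0 < innerAt v p p := innerAt_self_pos.mpr hp
  have ha : innerAt v w w • (p - v) - innerAt v p p • (w - v) ≠ 0 := by
    rw [← inner_self_ne_zero (𝕜 := ℝ)]
    have hnorm : inner ℝ (innerAt v w w • (p - v) - innerAt v p p • (w - v))
        (innerAt v w w • (p - v) - innerAt v p p • (w - v))
        = innerAt v w w * innerAt v p p * innerAt w p p := by
      simp only [innerAt, ← sub_sub_sub_cancel_right p w v]
      generalize p - v = P, w - v = W
      simp only [inner_sub_left, inner_sub_right, real_inner_smul_left, real_inner_smul_right]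
      rw [real_inner_comm W P]
      ring
    rw [hnorm]
    exact (mul_pos (mul_pos hw' hp') (innerAt_self_pos.mpr hpw)).ne'
  filter_upwards [ae_inner_sub_ne μ ha v 0] with x hx h
  refine hx ?_
  rw [inner_sub_left, real_inner_smul_left, real_inner_smul_left]
  exact sub_eq_zero.mpr (by rw [mul_comm, ← innerAt, h, ← innerAt, mul_comm])

theorem ae_generic {s : Set E} (hs : s.Countable) : ∀ᵐ x ∂μ, Generic s x := by
  have hdist : ∀ᵐ x ∂μ, ∀ v ∈ s, ∀ w ∈ s, v ≠ w → dist x v ≠ dist x w := by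
    simp only [ae_ball_iff hs, Filter.eventually_imp_distrib_left]
    intro v _ w _ hvw
    have hbis := μ.addHaar_affineSubspace (AffineSubspace.perpBisector v w)
      (AffineSubspace.perpBisector_eq_top.not.mpr hvw)
    filter_upwards [measure_eq_zero_iff_ae_notMem.mp hbis] with x hx
    exact fun h => hx (AffineSubspace.mem_perpBisector_iff_dist_eq.mpr h)
  have hray : ∀ᵐ x ∂μ, ∀ v ∈ s, ∀ w ∈ s, ∀ p ∈ s, w ≠ v → p ≠ v → p ≠ w →
      innerAt v p x * innerAt v w w ≠ innerAt v w x * innerAt v p p := by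
    simp only [ae_ball_iff hs, Filter.eventually_imp_distrib_left]
    exact fun v _ w _ p _ => ae_bisectors_ne μ
  filter_upwards [hdist, hray] with x hx₁ hx₂
  exact ⟨fun v hv w hw => not_imp_not.mp (hx₁ v hv w hw), hx₂⟩

end Measure

section ConvexHull

variable {s : Set E} {a v x y : E}

theorem inner_sub_nonpos_of_mem_convexHull (h : ∀ p ∈ s, inner ℝ a (p - v) ≤ 0)
    (hy : y ∈ convexHull ℝ s) : inner ℝ a (y - v) ≤ 0 := by
  simp only [inner_sub_right, sub_nonpos] at h ⊢
  exact convexHull_min h (convex_halfSpace_le (innerₛₗ ℝ a).isLinear _) hy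

theorem mem_frontier_convexHull_of_inner_sub_nonpos (ha : a ≠ 0) (hv : v ∈ convexHull ℝ s)
    (h : ∀ p ∈ s, inner ℝ a (p - v) ≤ 0) : v ∈ frontier (convexHull ℝ s) := by
  refine ⟨subset_closure hv, fun hint => ?_⟩
  have hopen : IsOpenMap (innerSL ℝ a) :=
    (innerSL ℝ a).isOpenMap_of_ne_zero (fun h0 => ha (innerSL_inj.mp (h0.trans (map_zero _).symm)))
  obtain ⟨_, hlt, y, hy, rfl⟩ := Filter.Eventually.exists_gt
    (hopen.image_mem_nhds (mem_interior_iff_mem_nhds.mp hint))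
  have := inner_sub_nonpos_of_mem_convexHull h hy
  rw [inner_sub_right, sub_nonpos] at this
  exact this.not_gt hlt

theorem segment_inter_convexHull_eq_singleton (hv : v ∈ convexHull ℝ s)
    (h : ∀ p ∈ s, inner ℝ a (p - v) ≤ 0) (hx : 0 < inner ℝ a (x - v)) :
    segment ℝ x v ∩ convexHull ℝ s = {v} := by
  refine Subset.antisymm ?_ (singleton_subset_iff.mpr ⟨right_mem_segment ℝ x v, hv⟩)
  rintro _ ⟨hseg, hhull⟩
  rw [segment_symm, segment_eq_image_lineMap] at hseg
  obtain ⟨t, ⟨ht, -⟩, rfl⟩ := hseg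
  have hle := inner_sub_nonpos_of_mem_convexHull h hhull
  rw [AffineMap.lineMap_apply_module', add_sub_cancel_right, real_inner_smul_right] at hle
  have ht0 : t = 0 := le_antisymm (nonpos_of_mul_nonpos_left hle hx) ht
  rw [ht0, AffineMap.lineMap_apply_zero, mem_singleton_iff]

theorem mem_convexHull_face (hv : v ∈ convexHull ℝ s) (h : ∀ p ∈ s, inner ℝ a (p - v) ≤ 0) :
    v ∈ convexHull ℝ {p ∈ s | inner ℝ a (p - v) = 0} := by
  set F := {p ∈ s | inner ℝ a (p - v) = 0}
  have hF : convexHull ℝ F ⊆ {y | inner ℝ a (y - v) ≤ 0} := fun y =>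
    inner_sub_nonpos_of_mem_convexHull fun p hp => hp.2.le
  have hconv : Convex ℝ ({y | inner ℝ a (y - v) < 0} ∪ convexHull ℝ F) := by
    rw [convex_iff_forall_pos]
    intro y hy z hz b c hb hc hbc
    have hcomb : inner ℝ a (b • y + c • z - v)
        = b * inner ℝ a (y - v) + c * inner ℝ a (z - v) := by
      rw [← real_inner_smul_right, ← real_inner_smul_right, ← inner_add_right, smul_sub, smul_sub,
        sub_add_sub_comm, ← add_smul, hbc, one_smul]
    simp only [mem_union, mem_ofPred_eq, hcomb] at hy hz ⊢
    obtain hy | hyF := hy <;> obtain hz | hzF := hz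
    · exact Or.inl (by nlinarith)
    · have := hF hzF
      simp only [mem_ofPred_eq] at this
      exact Or.inl (by nlinarith)
    · have := hF hyF
      simp only [mem_ofPred_eq] at this
      exact Or.inl (by nlinarith)
    · exact Or.inr (convex_convexHull ℝ F hyF hzF hb.le hc.le hbc)
  have hs : s ⊆ {y | inner ℝ a (y - v) < 0} ∪ convexHull ℝ F := fun p hp =>
    (h p hp).lt_or_eq.imp_right fun h0 => subset_convexHull ℝ F ⟨hp, h0⟩
  exact (convexHull_min hs hconv hv).resolve_left (by simp)

theorem exists_inner_sub_pos_of_mem_convexHull (hv : v ∈ convexHull ℝ s)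
    (h : ∀ p ∈ s, inner ℝ a (p - v) ≠ 0) : ∃ p ∈ s, 0 < inner ℝ a (p - v) := by
  by_contra! hle
  obtain ⟨p, hp, hp0⟩ := convexHull_nonempty_iff.mp ⟨v, mem_convexHull_face hv hle⟩
  exact h p hp hp0

theorem innerAt_nonpos_of_mem_normalCone (hx : x ∈ normalCone s v) (hy : y ∈ convexHull ℝ s) :
    innerAt v y x ≤ 0 := by
  rw [innerAt_comm]
  exact inner_sub_nonpos_of_mem_convexHull (fun p hp => (innerAt_comm v x p).trans_le (hx p hp)) hy

theorem eq_of_mem_normalCone (hv : v ∈ convexHull ℝ s) (hy : y ∈ convexHull ℝ s)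
    (hxv : x ∈ normalCone s v) (hxy : x ∈ normalCone s y) : v = y := by
  refine eq_of_innerAt_self_nonpos ?_
  have h := innerAt_eq_change_base v y v x
  rw [innerAt_eq_change_base v y v v]
  have h₁ := innerAt_nonpos_of_mem_normalCone hxv hy
  have h₂ := innerAt_nonpos_of_mem_normalCone hxy hv
  simp only [innerAt_base_left, innerAt_base_right] at h ⊢
  linarith

theorem exists_mem_convexHull_mem_normalCone (hs : s.Finite) (hne : s.Nonempty) (x : E) :
    ∃ q ∈ convexHull ℝ s, x ∈ normalCone s q := by
  have hconv : Convex ℝ (convexHull ℝ s) := convex_convexHull ℝ s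
  obtain ⟨q, hq, hmin⟩ := exists_norm_eq_iInf_of_complete_convex hne.convexHull
    (hs.isCompact_convexHull ℝ).isComplete hconv x
  refine ⟨q, hq, fun p hp => ?_⟩
  rw [innerAt_comm]
  exact (norm_eq_iInf_iff_real_inner_le_zero hconv hq).mp hmin p (subset_convexHull ℝ s hp)

end ConvexHull

end InnerProductSpace

section Line

open Filter

/-- The signed indicator function of the interval between `0` and `s`. -/
def signedInterval (s t : ℝ) : ℝ := (Iic s).indicator 1 t - (Iic 0).indicator 1 t

theorem measurable_signedInterval (s : ℝ) : Measurable (signedInterval s) :=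
  (measurable_one.indicator measurableSet_Iic).sub (measurable_one.indicator measurableSet_Iic)

theorem signedInterval_eq_sub_indicator_Ioc (s t : ℝ) :
    signedInterval s t = (Ioc 0 s).indicator 1 t - (Ioc s 0).indicator 1 t := by
  simp only [signedInterval, indicator, mem_Iic, mem_Ioc, Pi.one_apply]
  grind

theorem signedInterval_eq_zero {s t : ℝ} (h : |s| < |t|) : signedInterval s t = 0 := by
  simp only [signedInterval, indicator, mem_Iic, Pi.one_apply]
  grind

theorem abs_signedInterval_le_one (s t : ℝ) : |signedInterval s t| ≤ 1 := by
  simp only [signedInterval, indicator, mem_Iic, Pi.one_apply]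
  grind

theorem signedInterval_neg_neg {s t : ℝ} (ht : t ≠ 0) (hts : t ≠ s) :
    signedInterval (-s) (-t) = -signedInterval s t := by
  simp only [signedInterval, indicator, mem_Iic, Pi.one_apply]
  grind

theorem integral_signedInterval_mul {f : ℝ → ℝ} (hf : Continuous f) (s : ℝ) :
    ∫ t, signedInterval s t * f t = ∫ t in (0 : ℝ)..s, f t := by
  have hfun (t : ℝ) :
      signedInterval s t * f t = (Ioc 0 s).indicator f t - (Ioc s 0).indicator f t := by
    simp [signedInterval_eq_sub_indicator_Ioc, sub_mul, ← indicator_mul_left]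
  simp only [hfun]
  rw [integral_sub, integral_indicator measurableSet_Ioc, integral_indicator measurableSet_Ioc,
    intervalIntegral]
  · exact hf.integrableOn_Ioc.integrable_indicator measurableSet_Ioc
  · exact hf.integrableOn_Ioc.integrable_indicator measurableSet_Ioc

variable {ι : Type*} {J : Finset ι} {β γ : ι → ℝ}

/-- The polyhedron in `ℝ` cut out by the inequalities `β j * t ≤ γ j` with `j ∈ J`. -/
def linePolyhedron (J : Finset ι) (β γ : ι → ℝ) : Set ℝ := {t | ∀ j ∈ J, β j * t ≤ γ j}

theorem ordConnected_linePolyhedron : (linePolyhedron J β γ).OrdConnected := by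
  refine ⟨fun a ha b hb t ht j hj => ?_⟩
  obtain hβ | hβ := le_total 0 (β j)
  · exact (mul_le_mul_of_nonneg_left ht.2 hβ).trans (hb j hj)
  · exact (mul_le_mul_of_nonpos_left ht.1 hβ).trans (ha j hj)

theorem linePolyhedron_neg : linePolyhedron J (-β) γ = -linePolyhedron J β γ := by
  ext t
  simp [linePolyhedron]

theorem linePolyhedron_mem_atTop :
    linePolyhedron J β γ ∈ atTop ↔ ∀ j ∈ J, β j ≤ 0 ∧ (β j = 0 → 0 ≤ γ j) := by
  have hj (j : ι) : (∀ᶠ t in atTop, β j * t ≤ γ j) ↔ β j ≤ 0 ∧ (β j = 0 → 0 ≤ γ j) := by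
    obtain hβ | hβ | hβ := lt_trichotomy (β j) 0
    · simpa [hβ.le, hβ.ne] using (tendsto_id.const_mul_atTop_of_neg hβ).eventually_le_atBot (γ j)
    · simp only [hβ, zero_mul, eventually_const, le_refl, true_and, true_imp_iff]
    · have hgt := (tendsto_id.const_mul_atTop hβ).eventually_gt_atTop (γ j)
      exact iff_of_false (fun hle => (hle.and hgt).exists.elim fun _ h => h.1.not_gt h.2)
        (fun h => h.1.not_gt hβ)
  simp only [← hj]
  exact Filter.eventually_all_finset J

theorem neg_linePolyhedron_mem_atTop :
    -linePolyhedron J β γ ∈ atTop ↔ linePolyhedron J β γ ∈ atBot := by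
  rw [← map_neg_atTop]
  rfl

theorem linePolyhedron_mem_atBot :
    linePolyhedron J β γ ∈ atBot ↔ ∀ j ∈ J, 0 ≤ β j ∧ (β j = 0 → 0 ≤ γ j) := by
  rw [← neg_linePolyhedron_mem_atTop, ← linePolyhedron_neg, linePolyhedron_mem_atTop]
  simp only [Pi.neg_apply, Left.neg_nonpos_iff, neg_eq_zero]

theorem isGreatest_linePolyhedron {u : ι} (hu : u ∈ J) (hβ : 0 < β u)
    (hmem : γ u / β u ∈ linePolyhedron J β γ) :
    IsGreatest (linePolyhedron J β γ) (γ u / β u) :=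
  ⟨hmem, fun _ ht => (le_div_iff₀' hβ).mpr (ht u hu)⟩

theorem exists_mem_linePolyhedron_of_pos (hne : (linePolyhedron J β γ).Nonempty) {k : ι}
    (hk : k ∈ J) (hβk : 0 < β k) : ∃ u ∈ J, 0 < β u ∧ γ u / β u ∈ linePolyhedron J β γ := by
  classical
  obtain ⟨s, hs⟩ := hne
  obtain ⟨u, hu, hmin⟩ := (J.filter (0 < β ·)).exists_min_image (fun j => γ j / β j)
    ⟨k, Finset.mem_filter.mpr ⟨hk, hβk⟩⟩
  obtain ⟨huJ, hβu⟩ := Finset.mem_filter.mp hu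
  refine ⟨u, huJ, hβu, fun j hj => ?_⟩
  obtain hβj | hβj := lt_or_ge 0 (β j)
  · exact (le_div_iff₀' hβj).mp (hmin j (Finset.mem_filter.mpr ⟨hj, hβj⟩))
  · exact (mul_le_mul_of_nonpos_left ((le_div_iff₀' hβu).mpr (hs u huJ)) hβj).trans (hs j hj)

open Classical in
theorem sum_signedInterval_linePolyhedron
    (huniq : ∀ i ∈ J, ∀ j ∈ J, 0 < β i → 0 < β j → γ i / β i ∈ linePolyhedron J β γ →
      γ j / β j ∈ linePolyhedron J β γ → i = j)
    (hne : (linePolyhedron J β γ).Nonempty) (t : ℝ) :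
    ∑ u ∈ J with 0 < β u ∧ γ u / β u ∈ linePolyhedron J β γ, signedInterval (γ u / β u) t
      = (lowerClosure (linePolyhedron J β γ) : Set ℝ).indicator 1 t
        - if t ≤ 0 ∨ linePolyhedron J β γ ∈ atTop then 1 else 0 := by
  by_cases hpos : ∃ k ∈ J, 0 < β k
  · obtain ⟨k, hk, hβk⟩ := hpos
    obtain ⟨u, hu, hβu, hmem⟩ := exists_mem_linePolyhedron_of_pos hne hk hβk
    have htop : linePolyhedron J β γ ∉ atTop := fun h =>
      (linePolyhedron_mem_atTop.mp h k hk).1.not_gt hβk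
    have hclosure : (lowerClosure (linePolyhedron J β γ) : Set ℝ) = Iic (γ u / β u) := by
      ext t
      exact ⟨fun ⟨y, hy, hty⟩ => hty.trans ((isGreatest_linePolyhedron hu hβu hmem).2 hy),
        fun ht => ⟨_, hmem, ht⟩⟩
    rw [Finset.sum_eq_single_of_mem u (by simp [hu, hβu, hmem]), hclosure, signedInterval]
    · simp [htop, indicator]
    · intro j hj hju
      obtain ⟨hjJ, hβj, hmem'⟩ := Finset.mem_filter.mp hj
      exact absurd (huniq j hjJ u hu hβj hβu hmem' hmem) hju
  · push Not at hpos
    obtain ⟨s, hs⟩ := hne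
    have hIci (t : ℝ) (hst : s ≤ t) : t ∈ linePolyhedron J β γ := fun j hj =>
      (mul_le_mul_of_nonpos_left hst (hpos j hj)).trans (hs j hj)
    have htop : linePolyhedron J β γ ∈ atTop := mem_of_superset (Ici_mem_atTop s) hIci
    have hmem : t ∈ (lowerClosure (linePolyhedron J β γ) : Set ℝ) :=
      mem_lowerClosure.mpr ⟨max s t, hIci _ (le_max_left s t), le_max_right s t⟩
    rw [indicator_of_mem hmem, if_pos (Or.inr htop), Pi.one_apply, sub_self]
    exact Finset.sum_eq_zero fun u hu =>
      absurd (Finset.mem_filter.mp hu).2.1 (hpos u (Finset.mem_filter.mp hu).1).not_gt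

open Classical in
theorem sum_signedInterval_linePolyhedron_of_neg
    (huniq : ∀ i ∈ J, ∀ j ∈ J, β i < 0 → β j < 0 → γ i / β i ∈ linePolyhedron J β γ →
      γ j / β j ∈ linePolyhedron J β γ → i = j)
    (hne : (linePolyhedron J β γ).Nonempty) {t : ℝ} (ht : t ≠ 0)
    (hvertex : ∀ u ∈ J, β u < 0 → t ≠ γ u / β u) :
    ∑ u ∈ J with β u < 0 ∧ γ u / β u ∈ linePolyhedron J β γ, signedInterval (γ u / β u) t
      = (if 0 ≤ t ∨ linePolyhedron J β γ ∈ atBot then 1 else 0)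
        - (upperClosure (linePolyhedron J β γ) : Set ℝ).indicator 1 t := by
  have hdiv (u : ι) : γ u / -β u = -(γ u / β u) := div_neg _
  have hsum := sum_signedInterval_linePolyhedron (J := J) (β := -β) (γ := γ)
    (by simpa only [linePolyhedron_neg, Pi.neg_apply, hdiv, Set.neg_mem_neg, Left.neg_pos_iff]
      using huniq) (by simpa only [linePolyhedron_neg, Set.nonempty_neg] using hne) (-t)
  simp only [linePolyhedron_neg, Pi.neg_apply, hdiv, Set.neg_mem_neg, Left.neg_pos_iff] at hsum
  rw [Finset.sum_congr rfl fun u hu => signedInterval_neg_neg ht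
    (hvertex u (Finset.mem_filter.mp hu).1 (Finset.mem_filter.mp hu).2.1),
    Finset.sum_neg_distrib, neg_eq_iff_eq_neg, neg_sub] at hsum
  have hclosure : -t ∈ lowerClosure (-linePolyhedron J β γ)
      ↔ t ∈ upperClosure (linePolyhedron J β γ) := by
    simp only [mem_lowerClosure, mem_upperClosure, ← Set.image_neg_eq_neg, exists_mem_image,
      neg_le_neg_iff]
  simpa only [indicator, SetLike.mem_coe, hclosure, neg_linePolyhedron_mem_atTop,
    Left.neg_nonpos_iff, Pi.one_apply] using hsum

open Classical in
theorem indicator_linePolyhedron_sub_ite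
    (hupper : ∀ i ∈ J, ∀ j ∈ J, 0 < β i → 0 < β j → γ i / β i ∈ linePolyhedron J β γ →
      γ j / β j ∈ linePolyhedron J β γ → i = j)
    (hlower : ∀ i ∈ J, ∀ j ∈ J, β i < 0 → β j < 0 → γ i / β i ∈ linePolyhedron J β γ →
      γ j / β j ∈ linePolyhedron J β γ → i = j)
    {t : ℝ} (ht : t ≠ 0) (hvertex : ∀ u ∈ J, β u < 0 → t ≠ γ u / β u) :
    (linePolyhedron J β γ).indicator 1 t
        - (if 0 < t ∧ linePolyhedron J β γ ∈ atTop ∨ t < 0 ∧ linePolyhedron J β γ ∈ atBot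
            then 1 else 0)
      = ∑ u ∈ J with 0 < β u ∧ γ u / β u ∈ linePolyhedron J β γ, signedInterval (γ u / β u) t
        - ∑ u ∈ J with β u < 0 ∧ γ u / β u ∈ linePolyhedron J β γ,
            signedInterval (γ u / β u) t := by
  obtain hP | hP := (linePolyhedron J β γ).eq_empty_or_nonempty
  · simp [hP]
  rw [sum_signedInterval_linePolyhedron hupper hP,
    sum_signedInterval_linePolyhedron_of_neg hlower hP ht hvertex]
  have hinter : t ∈ linePolyhedron J β γ
      ↔ t ∈ upperClosure (linePolyhedron J β γ) ∧ t ∈ lowerClosure (linePolyhedron J β γ) :=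
    Set.ext_iff.mp ordConnected_linePolyhedron.upperClosure_inter_lowerClosure.symm t
  have hunion : t ∈ upperClosure (linePolyhedron J β γ)
      ∨ t ∈ lowerClosure (linePolyhedron J β γ) := by
    obtain ⟨s, hs⟩ := hP
    exact (le_total s t).imp (⟨s, hs, ·⟩) (⟨s, hs, ·⟩)
  simp only [indicator, SetLike.mem_coe, hinter, Pi.one_apply]
  grind

end Line

section Plane

/-- The cross product of the vectors from `o` to `p` and to `q`, twice the signed area of the
triangle `o p q`. -/
def crossAt (o p q : Plane) : ℝ := (p 0 - o 0) * (q 1 - o 1) - (p 1 - o 1) * (q 0 - o 0)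

theorem innerAt_eq_coord (o p q : Plane) :
    innerAt o p q = (p 0 - o 0) * (q 0 - o 0) + (p 1 - o 1) * (q 1 - o 1) := by
  simp only [innerAt, PiLp.inner_apply, Fin.sum_univ_two, PiLp.sub_apply, RCLike.inner_apply,
    conj_trivial]
  ring

theorem crossAt_eq_inner (o p q : Plane) :
    crossAt o p q = inner ℝ (!₂[-(p 1 - o 1), p 0 - o 0] : Plane) (q - o) := by
  simp only [crossAt, PiLp.inner_apply, Fin.sum_univ_two, PiLp.sub_apply, RCLike.inner_apply,
    conj_trivial, Matrix.cons_val_zero, Matrix.cons_val_one]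
  ring

@[simp]
theorem crossAt_base_right (o p : Plane) : crossAt o p o = 0 := by simp [crossAt]

@[simp]
theorem crossAt_self (o p : Plane) : crossAt o p p = 0 := by
  unfold crossAt
  ring

theorem crossAt_lineMap (v w : Plane) (r : ℝ) :
    crossAt v w (AffineMap.lineMap v w r) = 0 := by
  simp [crossAt, AffineMap.lineMap_apply_module']
  ring

theorem crossAt_swap (v w p : Plane) : crossAt w v p = -crossAt v w p := by
  unfold crossAt
  ring

theorem crossAt_rotate (v w u : Plane) : crossAt w u v = crossAt v w u := by
  unfold crossAt
  ring

theorem innerAt_mul_innerAt_eq (q x o p r : Plane) :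
    innerAt q x x * innerAt o p r
      = (innerAt q x p - innerAt q x o) * (innerAt q x r - innerAt q x o)
        + (crossAt q x p - crossAt q x o) * (crossAt q x r - crossAt q x o) := by
  simp only [innerAt_eq_coord, crossAt]
  ring

theorem innerAt_mul_crossAt_eq (q x o p r : Plane) :
    innerAt q x x * crossAt o p r
      = (innerAt q x p - innerAt q x o) * (crossAt q x r - crossAt q x o)
        - (crossAt q x p - crossAt q x o) * (innerAt q x r - innerAt q x o) := by
  simp only [innerAt_eq_coord, crossAt]
  ring

theorem innerAt_sq_add_crossAt_sq (v w x : Plane) :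
    innerAt v w x ^ 2 + crossAt v w x ^ 2 = innerAt v w w * innerAt v x x := by
  rw [innerAt_mul_innerAt_eq, innerAt_base_right, crossAt_base_right]
  ring

theorem innerAt_smul_sub_eq (v w x : Plane) :
    innerAt v w w • (x - v)
      = innerAt v w x • (w - v) + crossAt v w x • (!₂[-(w 1 - v 1), w 0 - v 0] : Plane) := by
  ext i
  fin_cases i <;> simp [innerAt_eq_coord, crossAt] <;> ring

theorem exists_eq_lineMap_of_crossAt_eq_zero {v w y : Plane} (hwv : w ≠ v)
    (h : crossAt v w y = 0) : ∃ r : ℝ, y = AffineMap.lineMap v w r := by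
  refine ⟨innerAt v w y / innerAt v w w, ?_⟩
  have hid := innerAt_smul_sub_eq v w y
  rw [h, zero_smul, add_zero] at hid
  rw [AffineMap.lineMap_apply_module', ← sub_eq_iff_eq_add, div_eq_inv_mul, mul_smul, ← hid,
    inv_smul_smul₀ (innerAt_self_pos.mpr hwv).ne']

theorem ae_crossAt_ne {v w : Plane} (hwv : w ≠ v) : ∀ᵐ x : Plane, crossAt v w x ≠ 0 := by
  simp only [crossAt_eq_inner]
  refine ae_inner_sub_ne _ (fun h => hwv ?_) v 0
  have h₀ := congrFun (congrArg WithLp.ofLp h) 0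
  have h₁ := congrFun (congrArg WithLp.ofLp h) 1
  simp only [Matrix.cons_val_zero, Matrix.cons_val_one, PiLp.zero_apply, neg_eq_zero] at h₀ h₁
  ext i
  fin_cases i
  · exact sub_eq_zero.mp h₁
  · exact sub_eq_zero.mp h₀

theorem measurable_innerAt_crossAt (v w : Plane) :
    Measurable fun x : Plane => (innerAt v w x, crossAt v w x) := by
  unfold innerAt crossAt
  fun_prop

theorem map_mulVec_sub_volume {M : Matrix (Fin 2) (Fin 2) ℝ} (hM : 0 < M.det) (v : Plane) :
    volume.map (fun x : Plane => (M.mulVec (x - v).ofLp 0, M.mulVec (x - v).ofLp 1))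
      = ENNReal.ofReal M.det⁻¹ • (volume : Measure (ℝ × ℝ)) := by
  have hcoord : MeasurePreserving (fun x : Plane => (x - v).ofLp) :=
    (PiLp.volume_preserving_ofLp (Fin 2)).comp (measurePreserving_sub_right volume v)
  have hpair := volume_preserving_finTwoArrow ℝ
  have hmeas : Measurable (Matrix.toLin' M) :=
    (LinearMap.continuous_of_finiteDimensional _).measurable
  have hcomp : (fun x : Plane => (M.mulVec (x - v).ofLp 0, M.mulVec (x - v).ofLp 1))
      = (MeasurableEquiv.finTwoArrow ∘ Matrix.toLin' M) ∘ fun x : Plane => (x - v).ofLp := rfl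
  rw [hcomp, ← Measure.map_map (hpair.measurable.comp hmeas) hcoord.measurable, hcoord.map_eq,
    ← Measure.map_map hpair.measurable hmeas, Real.map_matrix_volume_pi_eq_smul_volume_pi hM.ne',
    Measure.map_smul, hpair.map_eq, abs_of_pos (inv_pos.mpr hM)]

theorem map_innerAt_crossAt_volume {v w : Plane} (hwv : w ≠ v) :
    volume.map (fun x : Plane => (innerAt v w x, crossAt v w x))
      = ENNReal.ofReal (innerAt v w w)⁻¹ • (volume : Measure (ℝ × ℝ)) := by
  have hdet : !![w 0 - v 0, w 1 - v 1; -(w 1 - v 1), w 0 - v 0].det = innerAt v w w := by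
    rw [Matrix.det_fin_two_of, innerAt_eq_coord]
    ring
  rw [← hdet, ← map_mulVec_sub_volume (hdet ▸ innerAt_self_pos.mpr hwv) v]
  congr 1
  funext x
  simp [innerAt_eq_coord, crossAt, Matrix.mulVec, dotProduct]
  ring

theorem map_crossAt_crossAt_volume {v w u : Plane} (h : 0 < crossAt v w u) :
    volume.map (fun x : Plane => (crossAt u v x, crossAt v w x))
      = ENNReal.ofReal (crossAt v w u)⁻¹ • (volume : Measure (ℝ × ℝ)) := by
  have hdet : !![u 1 - v 1, -(u 0 - v 0); -(w 1 - v 1), w 0 - v 0].det = crossAt v w u := by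
    rw [Matrix.det_fin_two_of, crossAt]
    ring
  rw [← hdet, ← map_mulVec_sub_volume (hdet ▸ h) v]
  congr 1
  funext x
  simp [crossAt, Matrix.mulVec, dotProduct]
  constructor <;> ring

end Plane

section Segment

variable {E : Type*} [NormedAddCommGroup E] [InnerProductSpace ℝ E] {o p q v w x : E}

theorem innerAt_lineMap_right (o p v w : E) (r : ℝ) :
    innerAt o p (AffineMap.lineMap v w r) = (1 - r) * innerAt o p v + r * innerAt o p w := by
  have hsub : AffineMap.lineMap v w r - o = (1 - r) • (v - o) + r • (w - o) := by
    rw [AffineMap.lineMap_apply_module]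
    module
  rw [innerAt, hsub, inner_add_right, real_inner_smul_right, real_inner_smul_right, innerAt,
    innerAt]

theorem innerAt_lineMap_left (o p v w : E) (r : ℝ) :
    innerAt o (AffineMap.lineMap v w r) p = (1 - r) * innerAt o v p + r * innerAt o w p := by
  simp only [innerAt_comm o _ p, innerAt_lineMap_right]

theorem innerAt_lineMap_endpoints (v w : E) (r : ℝ) :
    innerAt (AffineMap.lineMap v w r) v w = -(r * (1 - r)) * innerAt v w w := by
  rw [innerAt_eq_change_base v]
  simp only [innerAt_lineMap_right, innerAt_lineMap_left, innerAt_base_left, innerAt_base_right]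
  ring

theorem innerAt_eq_zero_of_mem_normalCone {s : Set E} (hx : x ∈ normalCone s q) (hv : v ∈ s)
    (hw : w ∈ s) (hq : q ∈ openSegment ℝ v w) : innerAt q x v = 0 ∧ innerAt q x w = 0 := by
  have hxv := (innerAt_comm q x v).trans_le (hx v hv)
  have hxw := (innerAt_comm q x w).trans_le (hx w hw)
  rw [openSegment_eq_image_lineMap] at hq
  obtain ⟨r, ⟨hr₀, hr₁⟩, hr⟩ := hq
  have hsum := innerAt_lineMap_right q x v w r
  rw [hr, innerAt_base_right] at hsum
  constructor <;> nlinarith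

theorem lineMap_mem_openSegment_lineMap_right {r t : ℝ} (ht : 0 < t) (htr : t < r) :
    AffineMap.lineMap v w t ∈ openSegment ℝ v (AffineMap.lineMap v w r) := by
  have hr : 0 < r := ht.trans htr
  rw [openSegment_eq_image_lineMap]
  refine ⟨t / r, ⟨div_pos ht hr, (div_lt_one hr).mpr htr⟩, ?_⟩
  rw [AffineMap.lineMap_lineMap_right, div_mul_cancel₀ _ hr.ne']

theorem mem_openSegment_of_mem_openSegment_of_ne {w' : E} (hq : q ∈ openSegment ℝ v w)
    (hq' : q ∈ openSegment ℝ v w') (hne : w ≠ w') :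
    w ∈ openSegment ℝ v w' ∨ w' ∈ openSegment ℝ v w := by
  rw [openSegment_eq_image_lineMap] at hq hq'
  obtain ⟨t, ⟨ht₀, ht₁⟩, rfl⟩ := hq
  obtain ⟨t', ⟨ht₀', _⟩, h⟩ := hq'
  have hw : w = AffineMap.lineMap v w' (t' / t) := by
    rw [div_eq_inv_mul, ← AffineMap.lineMap_lineMap_right, h, AffineMap.lineMap_lineMap_right,
      inv_mul_cancel₀ ht₀.ne', AffineMap.lineMap_apply_one]
  have hw' : w' = AffineMap.lineMap v w (t / t') := by
    rw [div_eq_inv_mul, ← AffineMap.lineMap_lineMap_right, ← h, AffineMap.lineMap_lineMap_right,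
      inv_mul_cancel₀ ht₀'.ne', AffineMap.lineMap_apply_one]
  simp only [openSegment_eq_image_lineMap]
  obtain hlt | rfl | hlt := lt_trichotomy t' t
  · exact Or.inl ⟨_, ⟨div_pos ht₀' ht₀, (div_lt_one ht₀).mpr hlt⟩, hw.symm⟩
  · rw [div_self ht₀.ne', AffineMap.lineMap_apply_one] at hw
    exact absurd hw hne
  · exact Or.inr ⟨_, ⟨div_pos ht₀ ht₀', (div_lt_one ht₀').mpr hlt⟩, hw'.symm⟩

theorem dist_left_lt_of_mem_openSegment (hwv : w ≠ v) (hp : p ∈ openSegment ℝ v w) :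
    dist v p < dist v w := by
  rw [openSegment_eq_image_lineMap] at hp
  obtain ⟨r, ⟨hr₀, hr₁⟩, rfl⟩ := hp
  rw [dist_left_lineMap, Real.norm_of_nonneg hr₀.le]
  exact mul_lt_of_lt_one_left (dist_pos.mpr hwv.symm) hr₁

theorem mem_openSegment_or_of_ne (hp : p ∈ openSegment ℝ v w) (hq : q ∈ openSegment ℝ v w)
    (hpq : p ≠ q) : q ∈ openSegment ℝ v p ∨ q ∈ openSegment ℝ w p := by
  rw [openSegment_eq_image_lineMap] at hp hq
  obtain ⟨r, ⟨hr₀, hr₁⟩, rfl⟩ := hp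
  obtain ⟨t, ⟨ht₀, ht₁⟩, rfl⟩ := hq
  obtain htr | rfl | hrt := lt_trichotomy t r
  · exact Or.inl (lineMap_mem_openSegment_lineMap_right ht₀ htr)
  · exact absurd rfl hpq
  · rw [← AffineMap.lineMap_apply_one_sub w v r, ← AffineMap.lineMap_apply_one_sub w v t]
    exact Or.inr (lineMap_mem_openSegment_lineMap_right (by linarith) (by linarith))

theorem lineMap_mem_openSegment_of_dist_lt {r : ℝ} (hx : x ∈ nearStrip v w)
    (h : dist x (AffineMap.lineMap v w r) < dist x v) :
    AffineMap.lineMap v w r ∈ openSegment ℝ v w := by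
  obtain ⟨hpos, hnear⟩ := hx
  have hlt : r * (r * innerAt v w w) < 2 * (r * innerAt v w x) := by
    simpa only [innerAt_lineMap_left, innerAt_lineMap_right, innerAt_base_left,
      innerAt_base_right, mul_zero, zero_add] using
      not_le.mp (dist_le_dist_iff_innerAt.not.mp h.not_ge)
  have hr₀ : 0 < r := by
    by_contra! hr
    nlinarith [mul_nonneg_of_nonpos_of_nonpos hr hr]
  rw [openSegment_eq_image_lineMap]
  refine ⟨r, ⟨hr₀, ?_⟩, rfl⟩
  have hlt' : r * innerAt v w w < 2 * innerAt v w x := by nlinarith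
  nlinarith

theorem exists_mem_segment_innerAt_eq_zero (hxq : x ≠ q) {u : E} (hu : innerAt q x u ≤ 0) :
    ∃ y ∈ segment ℝ x u, innerAt q x y = 0 := by
  have hx : 0 < innerAt q x x := innerAt_self_pos.mpr hxq
  have hden : 0 < innerAt q x x - innerAt q x u := by linarith
  rw [segment_eq_image_lineMap]
  refine ⟨_, ⟨innerAt q x x / (innerAt q x x - innerAt q x u),
    ⟨div_nonneg hx.le hden.le, (div_le_one hden).mpr (by linarith)⟩, rfl⟩, ?_⟩
  rw [innerAt_lineMap_right]
  field_simp
  ring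

/-- The points which project to the edge `[v, w]` of the convex hull of `s`, at a point `q` of its
half adjacent to `v`, where `v` and `w` are consecutive points of `s` on the boundary. -/
def faceCell (s : Set E) (v w : E) : Set E :=
  {x ∈ nearStrip v w | Disjoint s (openSegment ℝ v w) ∧
    ∃ q ∈ openSegment ℝ v w, x ∈ normalCone s q ∧ x ≠ q}

end Segment

section Face

theorem mem_openSegment_iff {v w p : Plane} (hwv : w ≠ v) :
    p ∈ openSegment ℝ v w ↔ crossAt v w p = 0 ∧ innerAt p v w < 0 := by
  have hw : 0 < innerAt v w w := innerAt_self_pos.mpr hwv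
  rw [openSegment_eq_image_lineMap]
  constructor
  · rintro ⟨r, ⟨hr₀, hr₁⟩, rfl⟩
    refine ⟨crossAt_lineMap v w r, ?_⟩
    rw [innerAt_lineMap_endpoints]
    nlinarith [mul_pos (mul_pos hr₀ (sub_pos.mpr hr₁)) hw]
  · rintro ⟨hcross, hneg⟩
    obtain ⟨r, rfl⟩ := exists_eq_lineMap_of_crossAt_eq_zero hwv hcross
    rw [innerAt_lineMap_endpoints] at hneg
    have hr : 0 < r * (1 - r) := by nlinarith
    exact ⟨r, ⟨by nlinarith, by nlinarith⟩, rfl⟩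

theorem crossAt_eq_zero_of_innerAt_eq_zero {q x v w p : Plane} (hxq : x ≠ q)
    (hv : innerAt q x v = 0) (hw : innerAt q x w = 0) (hp : innerAt q x p = 0) :
    crossAt v w p = 0 := by
  have h := innerAt_mul_crossAt_eq q x v w p
  rw [hv, hw, hp, sub_self, zero_mul, mul_zero, sub_self] at h
  exact (mul_eq_zero.mp h).resolve_left (innerAt_self_pos.mpr hxq).ne'

theorem innerAt_mul_crossAt_of_innerAt_eq_zero {q x v w : Plane} (hxq : x ≠ q)
    (hv : innerAt q x v = 0) (hw : innerAt q x w = 0) (p : Plane) :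
    innerAt q x x * crossAt v w p = crossAt v w x * innerAt q x p := by
  have hx := innerAt_mul_crossAt_eq q x v w x
  have hp := innerAt_mul_crossAt_eq q x v w p
  rw [hv, hw, sub_self, zero_mul, zero_sub, sub_zero, ← neg_mul, mul_comm] at hx hp
  rw [mul_right_cancel₀ (innerAt_self_pos.mpr hxq).ne' hx, mul_comm, hp]

theorem crossAt_ne_zero_of_innerAt_eq_zero {q x v w : Plane} (hxq : x ≠ q) (hwv : w ≠ v)
    (hv : innerAt q x v = 0) (hw : innerAt q x w = 0) : crossAt v w x ≠ 0 := by
  intro h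
  have hN : innerAt q x x ≠ 0 := (innerAt_self_pos.mpr hxq).ne'
  have hcross := innerAt_mul_crossAt_eq q x v w x
  have hsq := innerAt_mul_innerAt_eq q x v w w
  rw [h, hv, hw] at hcross
  rw [hv, hw] at hsq
  have hD : crossAt q x w - crossAt q x v = 0 := by
    refine (mul_eq_zero.mp ?_).resolve_right hN
    linarith
  rw [hD, mul_zero, sub_self, mul_zero, add_zero] at hsq
  exact (mul_pos (innerAt_self_pos.mpr hxq) (innerAt_self_pos.mpr hwv)).ne' hsq

theorem innerAt_self_mul_innerAt_lineMap {v w x : Plane} {r : ℝ}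
    (hr : r * innerAt v w w = innerAt v w x) (p : Plane) :
    innerAt v w w * innerAt (AffineMap.lineMap v w r) x p = crossAt v w x * crossAt v w p := by
  have hbinet := innerAt_mul_innerAt_eq v w v x p
  rw [innerAt_base_right, crossAt_base_right] at hbinet
  rw [innerAt_eq_change_base v (AffineMap.lineMap v w r)]
  simp only [innerAt_lineMap_left, innerAt_lineMap_right, innerAt_base_left, innerAt_base_right,
    innerAt_comm v x w]
  linear_combination hbinet + (r * innerAt v w w - innerAt v w p) * hr

theorem mem_faceCell_iff {s : Set Plane} {v w x : Plane} (hv : v ∈ s) (hw : w ∈ s) :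
    x ∈ faceCell s v w ↔ x ∈ nearStrip v w ∧ crossAt v w x ≠ 0 ∧
      ∀ p ∈ s, crossAt v w p * crossAt v w x ≤ 0 ∧ (crossAt v w p = 0 → 0 ≤ innerAt p v w) := by
  refine and_congr_right fun ⟨hpos, hnear⟩ => ?_
  have hww : 0 < innerAt v w w := by linarith
  have hwv : w ≠ v := innerAt_self_pos.mp hww
  have disjoint_iff : Disjoint s (openSegment ℝ v w) ↔
      ∀ p ∈ s, crossAt v w p = 0 → 0 ≤ innerAt p v w := by
    simp only [disjoint_left, mem_openSegment_iff hwv, not_and, not_lt]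
  rw [disjoint_iff]
  constructor
  · rintro ⟨hcons, q, hq, hxq, hne⟩
    obtain ⟨hqv, hqw⟩ := innerAt_eq_zero_of_mem_normalCone hxq hv hw hq
    refine ⟨crossAt_ne_zero_of_innerAt_eq_zero hne hwv hqv hqw, fun p hp => ⟨?_, hcons p hp⟩⟩
    refine nonpos_of_mul_nonpos_right ?_ (innerAt_self_pos.mpr hne)
    rw [← mul_assoc, innerAt_mul_crossAt_of_innerAt_eq_zero hne hqv hqw, mul_right_comm]
    exact mul_nonpos_of_nonneg_of_nonpos (mul_self_nonneg _)
      ((innerAt_comm q x p).trans_le (hxq p hp))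
  · rintro ⟨hcross, hp⟩
    set r := innerAt v w x / innerAt v w w with hr
    have hfoot := innerAt_self_mul_innerAt_lineMap (div_mul_cancel₀ (innerAt v w x) hww.ne')
    refine ⟨fun p hps => (hp p hps).2, AffineMap.lineMap v w r, ?_, fun p hps => ?_, fun h => ?_⟩
    · rw [openSegment_eq_image_lineMap]
      exact ⟨r, ⟨div_pos hpos hww, (div_lt_one hww).mpr (by linarith)⟩, rfl⟩
    · rw [innerAt_comm]
      exact nonpos_of_mul_nonpos_right ((hfoot p).trans_le (mul_comm (crossAt v w x) _ ▸
        (hp p hps).1)) hww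
    · have := hfoot x
      rw [← hr, ← h, innerAt_base_left, mul_zero] at this
      exact hcross (mul_self_eq_zero.mp this.symm)

end Face

section Visible

variable {S : Finset Plane} {q v w x : Plane}

theorem mem_hull {p : Plane} (hp : p ∈ S) : p ∈ hull S := subset_convexHull ℝ _ hp

theorem openSegment_subset_hull (hv : v ∈ S) (hw : w ∈ S) : openSegment ℝ v w ⊆ hull S :=
  (convex_convexHull ℝ _).openSegment_subset (mem_hull hv) (mem_hull hw)

theorem notMem_hull_of_mem_normalCone (hx : x ∈ normalCone (S : Set Plane) q) (hxq : x ≠ q) :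
    x ∉ hull S := fun h =>
  hxq (eq_of_innerAt_self_nonpos (innerAt_nonpos_of_mem_normalCone hx h))

theorem mem_frontier_hull {y : Plane} (hx : x ∈ normalCone (S : Set Plane) q) (hxq : x ≠ q)
    (hy : y ∈ hull S) (h : innerAt q x y = 0) : y ∈ frontier (hull S) := by
  refine mem_frontier_convexHull_of_inner_sub_nonpos (sub_ne_zero.mpr hxq) hy fun p hp => ?_
  rw [← sub_sub_sub_cancel_right p y q, inner_sub_right, ← innerAt, ← innerAt, h, sub_zero,
    innerAt_comm]
  exact hx p hp

theorem mem_visibleVertices (hx : x ∈ normalCone (S : Set Plane) q) (hxq : x ≠ q) (hv : v ∈ S)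
    (h : innerAt q x v = 0) : v ∈ visibleVertices S x := by
  refine ⟨⟨hv, mem_frontier_hull hx hxq (mem_hull hv) h⟩,
    segment_inter_convexHull_eq_singleton (a := x - q) (mem_hull hv) (fun p hp => ?_) ?_⟩ <;>
  rw [← sub_sub_sub_cancel_right _ v q, inner_sub_right, ← innerAt, ← innerAt, h, sub_zero]
  · rw [innerAt_comm]
    exact hx p hp
  · exact innerAt_self_pos.mpr hxq

theorem isNearest_visibleVertices_of_mem_normalCone (hv : v ∈ S)
    (hx : x ∈ normalCone (S : Set Plane) v) (hxv : x ≠ v) :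
    IsNearest (visibleVertices S x) x v :=
  ⟨mem_visibleVertices hx hxv hv (innerAt_base_right v x),
    fun u hu => normalCone_subset_voronoiCell hx u hu.1.1⟩

theorem notMem_hull_of_mem_faceCell (hx : x ∈ faceCell (S : Set Plane) v w) : x ∉ hull S := by
  obtain ⟨-, -, q, -, hxq, hne⟩ := hx
  exact notMem_hull_of_mem_normalCone hxq hne

theorem segment_subset_frontier_of_mem_faceCell (hv : v ∈ S) (hw : w ∈ S)
    (hx : x ∈ faceCell (S : Set Plane) v w) : segment ℝ v w ⊆ frontier (hull S) := by
  obtain ⟨-, -, q, hq, hxq, hne⟩ := hx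
  obtain ⟨hqv, hqw⟩ := innerAt_eq_zero_of_mem_normalCone hxq hv hw hq
  intro y hy
  refine mem_frontier_hull hxq hne
    ((convex_convexHull ℝ _).segment_subset (mem_hull hv) (mem_hull hw) hy) ?_
  rw [segment_eq_image_lineMap] at hy
  obtain ⟨r, -, rfl⟩ := hy
  rw [innerAt_lineMap_right, hqv, hqw, mul_zero, mul_zero, add_zero]

/-- A visible vertex `u` closer to `x` than `v` would be met, from `x`, before or at the line `vw`,
and at a point of the open segment `vw`, since that point is closer to `x` than `v` too. -/
theorem isNearest_visibleVertices_of_mem_faceCell (hv : v ∈ S) (hw : w ∈ S)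
    (hx : x ∈ faceCell (S : Set Plane) v w) : IsNearest (visibleVertices S x) x v := by
  obtain ⟨hstrip, hcons, q, hq, hxq, hne⟩ := hx
  have hwv : w ≠ v := by
    rintro rfl
    exact nearStrip_self.subset hstrip
  obtain ⟨hqv, hqw⟩ := innerAt_eq_zero_of_mem_normalCone hxq hv hw hq
  refine ⟨mem_visibleVertices hxq hne hv hqv, fun u ⟨⟨hu, _⟩, hvis⟩ => ?_⟩
  by_contra! hlt
  obtain ⟨y, hy, hqy⟩ := exists_mem_segment_innerAt_eq_zero hne
    ((innerAt_comm q x u).trans_le (hxq u hu))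
  have hyv : dist x y < dist x v := by
    have := segment_subset_closedBall_left x u hy
    rw [Metric.mem_closedBall, dist_comm] at this
    exact this.trans_lt hlt
  obtain ⟨r, rfl⟩ := exists_eq_lineMap_of_crossAt_eq_zero hwv
    (crossAt_eq_zero_of_innerAt_eq_zero hne hqv hqw hqy)
  have hmem := lineMap_mem_openSegment_of_dist_lt hstrip hyv
  have hyu := hvis.subset ⟨hy, openSegment_subset_hull hv hw hmem⟩
  rw [mem_singleton_iff] at hyu
  exact disjoint_left.mp hcons hu (hyu ▸ hmem)

theorem eq_of_mem_faceCell {w' : Plane} (hv : v ∈ S) (hw : w ∈ S) (hw' : w' ∈ S)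
    (hx : x ∈ faceCell (S : Set Plane) v w) (hx' : x ∈ faceCell (S : Set Plane) v w') :
    w' = w := by
  obtain ⟨-, hcons, q, hq, hxq, -⟩ := hx
  obtain ⟨-, hcons', q', hq', hxq', -⟩ := hx'
  obtain rfl := eq_of_mem_normalCone (openSegment_subset_hull hv hw hq)
    (openSegment_subset_hull hv hw' hq') hxq hxq'
  by_contra hne
  exact (mem_openSegment_of_mem_openSegment_of_ne hq' hq hne).elim
    (disjoint_left.mp hcons hw') (disjoint_left.mp hcons' hw)

theorem notMem_normalCone_of_mem_faceCell {u : Plane} (hu : u ∈ S) (hv : v ∈ S) (hw : w ∈ S)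
    (hx : x ∈ faceCell (S : Set Plane) v w) : x ∉ normalCone (S : Set Plane) u := by
  obtain ⟨-, hcons, q, hq, hxq, -⟩ := hx
  intro h
  obtain rfl := eq_of_mem_normalCone (openSegment_subset_hull hv hw hq) (mem_hull hu) hxq h
  exact disjoint_left.mp hcons hu hq

theorem exists_mem_openSegment_of_mem_normalCone (hq : q ∈ hull S) (hqS : q ∉ S)
    (hx : x ∈ normalCone (S : Set Plane) q) (hxq : x ≠ q) :
    ∃ v ∈ S, ∃ w ∈ S, q ∈ openSegment ℝ v w := by
  have hface : q ∈ convexHull ℝ {p ∈ (S : Set Plane) | innerAt q x p = 0} :=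
    mem_convexHull_face hq fun p hp => (innerAt_comm q x p).trans_le (hx p hp)
  obtain ⟨v, hv, hqv⟩ := convexHull_nonempty_iff.mp ⟨q, hface⟩
  have hN : innerAt q x x ≠ 0 := (innerAt_self_pos.mpr hxq).ne'
  have hcross : ∀ p ∈ S, innerAt q x p = 0 → crossAt q x p ≠ 0 := by
    intro p hp hqp h
    have := innerAt_sq_add_crossAt_sq q x p
    rw [hqp, h, zero_pow two_ne_zero, add_zero] at this
    exact hqS (eq_of_innerAt_self_nonpos
      ((mul_eq_zero.mp this.symm).resolve_left hN).le ▸ hp)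
  have hne : ∀ p ∈ {p ∈ (S : Set Plane) | innerAt q x p = 0}, inner ℝ (q - v) (p - q) ≠ 0 := by
    rintro p ⟨hp, hqp⟩ h
    have hvp : innerAt q v p = 0 := by rw [innerAt, ← neg_sub q v, inner_neg_left, h, neg_zero]
    have hbinet := innerAt_mul_innerAt_eq q x q v p
    rw [hqv, hqp, hvp, innerAt_base_right, crossAt_base_right] at hbinet
    refine mul_ne_zero (hcross v hv hqv) (hcross p hp hqp) ?_
    linarith
  obtain ⟨w, ⟨hw, hqw⟩, hpos⟩ := exists_inner_sub_pos_of_mem_convexHull hface hne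
  have hvw : innerAt q v w < 0 := by
    rwa [innerAt, ← neg_sub q v, inner_neg_left, neg_lt_zero]
  have hwv : w ≠ v := by
    rintro rfl
    exact hvw.not_ge (innerAt_self_nonneg q w)
  exact ⟨v, hv, w, hw, (mem_openSegment_iff hwv).mpr
    ⟨crossAt_eq_zero_of_innerAt_eq_zero hxq hqv hqw (innerAt_base_right q x), hvw⟩⟩

theorem exists_disjoint_openSegment (hqS : q ∉ S) (hex : ∃ v ∈ S, ∃ w ∈ S, q ∈ openSegment ℝ v w) :
    ∃ v ∈ S, ∃ w ∈ S, q ∈ openSegment ℝ v w ∧ Disjoint (S : Set Plane) (openSegment ℝ v w) := by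
  classical
  obtain ⟨v₀, hv₀, w₀, hw₀, hq₀⟩ := hex
  obtain ⟨⟨v, w⟩, hmem, hmin⟩ :=
    ((S ×ˢ S).filter fun p => q ∈ openSegment ℝ p.1 p.2).exists_min_image
      (fun p => dist p.1 p.2) ⟨(v₀, w₀), by simp [hv₀, hw₀, hq₀]⟩
  simp only [Finset.mem_filter, Finset.mem_product, and_imp, Prod.forall] at hmem hmin
  obtain ⟨⟨hv, hw⟩, hq⟩ := hmem
  have hwv : w ≠ v := by
    rintro rfl
    rw [openSegment_same, mem_singleton_iff] at hq
    exact hqS (hq ▸ hw)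
  refine ⟨v, hv, w, hw, hq, disjoint_left.mpr fun p hp hpseg => ?_⟩
  obtain h | h := mem_openSegment_or_of_ne hpseg hq (fun h => hqS (h ▸ hp))
  · exact (hmin v p hv hp h).not_gt (dist_left_lt_of_mem_openSegment hwv hpseg)
  · refine (hmin w p hw hp h).not_gt ?_
    rw [dist_comm v w]
    exact dist_left_lt_of_mem_openSegment hwv.symm (openSegment_symm ℝ v w ▸ hpseg)

theorem mem_faceCell_of_dist_lt (hv : v ∈ S) (hw : w ∈ S) (hq : q ∈ openSegment ℝ v w)
    (hcons : Disjoint (S : Set Plane) (openSegment ℝ v w))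
    (hx : x ∈ normalCone (S : Set Plane) q) (hxq : x ≠ q) (hlt : dist x v < dist x w) :
    x ∈ faceCell (S : Set Plane) v w := by
  obtain ⟨hqv, hqw⟩ := innerAt_eq_zero_of_mem_normalCone hx hv hw hq
  refine ⟨⟨?_, dist_lt_dist_iff_innerAt.mp hlt⟩, hcons, q, hq, hx, hxq⟩
  have hwv : w ≠ v := by
    rintro rfl
    exact hlt.false
  have hproj : innerAt v w x = innerAt v w q := by
    rw [innerAt_eq_change_base q v w x, innerAt_eq_change_base q v w q, innerAt_comm q w x, hqw,
      innerAt_comm q v x, hqv, innerAt_base_right, innerAt_base_right]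
  rw [openSegment_eq_image_lineMap] at hq
  obtain ⟨r, ⟨hr, -⟩, rfl⟩ := hq
  rw [hproj, innerAt_lineMap_right, innerAt_base_right, mul_zero, zero_add]
  exact mul_pos hr (innerAt_self_pos.mpr hwv)

theorem Generic.exists_mem_normalCone_or_mem_faceCell (hx : Generic (S : Set Plane) x)
    (hne : S.Nonempty) (hxS : x ∉ hull S) :
    ∃ v ∈ S, x ∈ normalCone (S : Set Plane) v ∨ ∃ w ∈ S, x ∈ faceCell (S : Set Plane) v w := by
  obtain ⟨q, hq, hxq⟩ := exists_mem_convexHull_mem_normalCone S.finite_toSet hne x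
  have hneq : x ≠ q := fun h => hxS (h ▸ hq)
  by_cases hqS : q ∈ S
  · exact ⟨q, hqS, Or.inl hxq⟩
  obtain ⟨v, hv, w, hw, hseg, hcons⟩ := exists_disjoint_openSegment hqS
    (exists_mem_openSegment_of_mem_normalCone hq hqS hxq hneq)
  obtain hlt | heq | hlt := lt_trichotomy (dist x v) (dist x w)
  · exact ⟨v, hv, Or.inr ⟨w, hw, mem_faceCell_of_dist_lt hv hw hseg hcons hxq hneq hlt⟩⟩
  · obtain rfl := hx.injOn_dist hv hw heq
    rw [openSegment_same, mem_singleton_iff] at hseg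
    exact absurd (hseg ▸ hv) hqS
  · rw [openSegment_symm] at hseg hcons
    exact ⟨w, hw, Or.inr ⟨v, hv, mem_faceCell_of_dist_lt hw hv hseg hcons hxq hneq hlt⟩⟩

/-- The points outside the convex hull of `s` whose nearest visible vertex is `v`, up to a null
set, and `v` itself. -/
def visibleCell (s : Set Plane) (v : Plane) : Set Plane :=
  normalCone s v ∪ ⋃ w ∈ s, faceCell s v w

theorem sum_indicator_faceCell (hv : v ∈ S) :
    ∑ w ∈ S, (faceCell (S : Set Plane) v w).indicator 1 x
      = (visibleCell (S : Set Plane) v).indicator (1 : Plane → ℝ) x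
        - (normalCone (S : Set Plane) v).indicator 1 x := by
  have hdisj : Disjoint (normalCone (S : Set Plane) v)
      (⋃ w ∈ (S : Set Plane), faceCell (S : Set Plane) v w) := by
    refine disjoint_left.mpr fun y hy hmem => ?_
    obtain ⟨w, hw, hyw⟩ := mem_iUnion₂.mp hmem
    exact notMem_normalCone_of_mem_faceCell hv hv hw hyw hy
  have hpair : (S : Set Plane).PairwiseDisjoint (faceCell (S : Set Plane) v) :=
    fun w hw w' hw' hne => disjoint_left.mpr fun y hy hy' =>
      hne (eq_of_mem_faceCell hv hw' hw hy' hy)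
  rw [visibleCell, indicator_union_of_disjoint hdisj, add_sub_cancel_left]
  exact (Finset.indicator_biUnion_apply S _ hpair x).symm

theorem isNearest_visibleVertices_of_mem_visibleCell (hv : v ∈ S)
    (hx : x ∈ visibleCell (S : Set Plane) v) (hxS : x ∉ hull S) :
    IsNearest (visibleVertices S x) x v := by
  obtain hxv | hxv := hx
  · exact isNearest_visibleVertices_of_mem_normalCone hv hxv fun h => hxS (h ▸ mem_hull hv)
  · obtain ⟨w, hw, hxw⟩ := mem_iUnion₂.mp hxv
    exact isNearest_visibleVertices_of_mem_faceCell hv hw hxw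

theorem Generic.exists_mem_visibleCell (hx : Generic (S : Set Plane) x) (hne : S.Nonempty)
    (hxS : x ∉ hull S) : ∃ v ∈ S, x ∈ visibleCell (S : Set Plane) v := by
  obtain ⟨v, hv, h⟩ := hx.exists_mem_normalCone_or_mem_faceCell hne hxS
  exact ⟨v, hv, h.imp_right fun ⟨w, hw, hxw⟩ => mem_iUnion₂.mpr ⟨w, hw, hxw⟩⟩

theorem eq_of_mem_visibleCell_of_mem_hull (hx : x ∈ visibleCell (S : Set Plane) v)
    (hxS : x ∈ hull S) : x = v := by
  obtain hxv | hxv := hx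
  · by_contra hne
    exact notMem_hull_of_mem_normalCone hxv hne hxS
  · obtain ⟨w, -, hxw⟩ := mem_iUnion₂.mp hxv
    exact absurd hxS (notMem_hull_of_mem_faceCell hxw)

open Classical in
theorem Generic.sum_dist_sq_mul_indicator_visibleCell (hx : Generic (S : Set Plane) x)
    (hne : S.Nonempty) {n : Plane} (hn : x ∉ hull S → IsNearest (visibleVertices S x) x n) :
    ∑ v ∈ S, dist x v ^ 2 * (visibleCell (S : Set Plane) v).indicator 1 x
      = if x ∈ hull S then 0 else dist x n ^ 2 := by
  split_ifs with hxS
  · refine Finset.sum_eq_zero fun v _ => mul_eq_zero.mpr ?_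
    by_cases hv : x ∈ visibleCell (S : Set Plane) v
    · rw [eq_of_mem_visibleCell_of_mem_hull hv hxS, dist_self, zero_pow two_ne_zero]
      exact Or.inl rfl
    · exact Or.inr (indicator_of_notMem hv _)
  · obtain ⟨v, hv, hxv⟩ := hx.exists_mem_visibleCell hne hxS
    have hnear := isNearest_visibleVertices_of_mem_visibleCell hv hxv hxS
    rw [Finset.sum_eq_single_of_mem v hv, indicator_of_mem hxv, Pi.one_apply, mul_one,
      le_antisymm (hnear.2 n (hn hxS).1) ((hn hxS).2 v hnear.1)]
    intro u hu huv
    rw [indicator_of_notMem, mul_zero]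
    intro hxu
    have hnear' := isNearest_visibleVertices_of_mem_visibleCell hu hxu hxS
    exact huv (hx.injOn_dist hu hv
      (le_antisymm (hnear'.2 v hnear.1) (hnear.2 u hnear'.1)))

open Classical in
theorem Generic.cellIntegrand_eq_sum (hx : Generic (S : Set Plane) x) (hne : S.Nonempty)
    {N NV : Plane → Plane} (hN : IsNearest (S : Set Plane) x (N x))
    (hNV : x ∉ hull S → IsNearest (visibleVertices S x) x (NV x)) :
    cellIntegrand S N NV x = ∑ v ∈ S, ∑ w ∈ S, dist x v ^ 2 *
      ((exitCell (S : Set Plane) v w).indicator 1 x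
        - (faceCell (S : Set Plane) v w).indicator 1 x) := by
  rw [cellIntegrand, ← hx.sum_dist_sq_mul_indicator_voronoiCell hN.1 hN.2,
    ← hx.sum_dist_sq_mul_indicator_visibleCell hne hNV, ← Finset.sum_sub_distrib]
  refine Finset.sum_congr rfl fun v hv => ?_
  rw [← Finset.mul_sum, Finset.sum_sub_distrib, hx.sum_indicator_exitCell hv,
    sum_indicator_faceCell hv]
  ring

end Visible

section Flag

/-- The density `|x - v|²` on the signed right triangle with vertices `v`, the midpoint `m` of
`[v, w]`, and the point of the perpendicular bisector at signed distance `s * |w - v|` from `m`,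
as a function of the inner and the cross product of `w - v` and `x - v`, where `c = |w - v|²`. -/
def flagDensity (c s : ℝ) (y : ℝ × ℝ) : ℝ :=
  (Ioo 0 (c / 2)).indicator
    (fun a => signedInterval s (y.2 / (2 * a)) * ((a ^ 2 + y.2 ^ 2) / c)) y.1

theorem measurable_flagDensity (c s : ℝ) : Measurable (flagDensity c s) := by
  have hfun : Measurable fun y : ℝ × ℝ =>
      signedInterval s (y.2 / (2 * y.1)) * ((y.1 ^ 2 + y.2 ^ 2) / c) :=
    ((measurable_signedInterval s).comp (by fun_prop)).mul (by fun_prop)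
  exact hfun.indicator (measurable_fst measurableSet_Ioo)

theorem support_flagDensity_subset {c s : ℝ} :
    Function.support (flagDensity c s) ⊆ Ioo 0 (c / 2) ×ˢ Icc (-(c * |s|)) (c * |s|) := by
  intro y hy
  have hy₁ : y.1 ∈ Ioo 0 (c / 2) := mem_of_indicator_ne_zero hy
  rw [Function.mem_support, flagDensity, indicator_of_mem hy₁] at hy
  have hle : |y.2 / (2 * y.1)| ≤ |s| := by
    by_contra! h
    exact hy (by rw [signedInterval_eq_zero h, zero_mul])
  have hpos : 0 < 2 * y.1 := by linarith [hy₁.1]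
  rw [abs_div, abs_of_pos hpos, div_le_iff₀ hpos] at hle
  exact ⟨hy₁, abs_le.mp (by nlinarith [hy₁.2, abs_nonneg s])⟩

theorem norm_flagDensity_le {c s : ℝ} {y : ℝ × ℝ}
    (hy : y ∈ Ioo 0 (c / 2) ×ˢ Icc (-(c * |s|)) (c * |s|)) :
    ‖flagDensity c s y‖ ≤ ((c / 2) ^ 2 + (c * |s|) ^ 2) / c := by
  obtain ⟨hy₁, hy₂⟩ := hy
  have hc : 0 < c := by linarith [hy₁.1, hy₁.2]
  rw [flagDensity, indicator_of_mem hy₁, norm_mul, Real.norm_eq_abs, Real.norm_eq_abs,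
    abs_of_nonneg (a := (y.1 ^ 2 + y.2 ^ 2) / c) (by positivity)]
  calc |signedInterval s (y.2 / (2 * y.1))| * ((y.1 ^ 2 + y.2 ^ 2) / c)
      ≤ 1 * ((y.1 ^ 2 + y.2 ^ 2) / c) := by
        gcongr
        exact abs_signedInterval_le_one _ _
    _ ≤ ((c / 2) ^ 2 + (c * |s|) ^ 2) / c := by
        rw [one_mul]
        gcongr ?_ / c
        exact add_le_add (pow_le_pow_left₀ hy₁.1.le hy₁.2.le 2) (sq_le_sq' hy₂.1 hy₂.2)

theorem integrable_flagDensity (c s : ℝ) : Integrable (flagDensity c s) := by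
  rw [← integrableOn_iff_integrable_of_support_subset support_flagDensity_subset]
  refine Measure.integrableOn_of_bounded (M := ((c / 2) ^ 2 + (c * |s|) ^ 2) / c) ?_
    (measurable_flagDensity c s).aestronglyMeasurable ?_
  · rw [Measure.volume_eq_prod, Measure.prod_prod]
    exact (ENNReal.mul_lt_top measure_Ioo_lt_top measure_Icc_lt_top).ne
  · filter_upwards [ae_restrict_mem (measurableSet_Ioo.prod measurableSet_Icc)] with y hy
    exact norm_flagDensity_le hy

theorem integral_one_add_four_mul_sq (s : ℝ) :
    ∫ t in (0 : ℝ)..s, (1 + 4 * t ^ 2) = s + 4 * s ^ 3 / 3 := by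
  rw [intervalIntegral.integral_add (Continuous.intervalIntegrable (by fun_prop) _ _)
      (Continuous.intervalIntegrable (by fun_prop) _ _),
    intervalIntegral.integral_const_mul, integral_pow]
  simp
  ring

theorem integral_flagDensity_slice (c s a : ℝ) :
    ∫ b, flagDensity c s (a, b)
      = (Ioo 0 (c / 2)).indicator (fun a => 2 * (s + 4 * s ^ 3 / 3) / c * a ^ 3) a := by
  by_cases ha : a ∈ Ioo 0 (c / 2)
  · have ha₀ : a ≠ 0 := ha.1.ne'
    have hslice (b : ℝ) : flagDensity c s (a, b)
        = a ^ 2 / c * (signedInterval s (b / (2 * a)) * (1 + 4 * (b / (2 * a)) ^ 2)) := by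
      simp only [flagDensity, indicator_of_mem ha]
      field_simp
      ring
    simp only [hslice]
    rw [Measure.integral_comp_div
        (fun t => a ^ 2 / c * (signedInterval s t * (1 + 4 * t ^ 2))) (2 * a),
      integral_const_mul, integral_signedInterval_mul (by fun_prop) s,
      integral_one_add_four_mul_sq, indicator_of_mem ha, abs_of_pos (by linarith [ha.1]),
      smul_eq_mul]
    ring
  · simp only [flagDensity, indicator_of_notMem ha, integral_zero]

theorem integral_flagDensity {c : ℝ} (hc : 0 < c) (s : ℝ) :
    ∫ y, flagDensity c s y = c ^ 3 / 32 * (s + 4 * s ^ 3 / 3) := by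
  have hint := integrable_flagDensity c s
  rw [Measure.volume_eq_prod] at hint ⊢
  rw [integral_prod _ hint]
  simp only [integral_flagDensity_slice]
  rw [integral_indicator measurableSet_Ioo, ← integral_Ioc_eq_integral_Ioo,
    ← intervalIntegral.integral_of_le (by linarith), intervalIntegral.integral_const_mul,
    integral_pow]
  push_cast
  field_simp
  ring

/-- The squared distance to `v` on the signed right triangle with vertices `v`, the midpoint of
`[v, w]`, and the point with parameter `s` of the perpendicular bisector of `v` and `w`. -/
def flag (v w : Plane) (s : ℝ) (x : Plane) : ℝ :=
  flagDensity (innerAt v w w) s (innerAt v w x, crossAt v w x)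

variable {v w x : Plane}

theorem integrable_flag (hwv : w ≠ v) (s : ℝ) : Integrable (flag v w s) := by
  have h := (integrable_flagDensity (innerAt v w w) s).smul_measure
    (ENNReal.ofReal_ne_top (r := (innerAt v w w)⁻¹))
  rw [← map_innerAt_crossAt_volume hwv] at h
  exact h.comp_measurable (measurable_innerAt_crossAt v w)

theorem integral_flag (hwv : w ≠ v) (s : ℝ) :
    ∫ x, flag v w s x = innerAt v w w ^ 2 / 32 * (s + 4 * s ^ 3 / 3) := by
  have hc : 0 < innerAt v w w := innerAt_self_pos.mpr hwv
  have hmap := integral_map (measurable_innerAt_crossAt v w).aemeasurable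
    (measurable_flagDensity (innerAt v w w) s).aestronglyMeasurable (μ := volume)
  unfold flag
  rw [← hmap, map_innerAt_crossAt_volume hwv, integral_smul_measure, integral_flagDensity hc,
    ENNReal.toReal_ofReal (inv_pos.mpr hc).le, smul_eq_mul]
  field_simp

theorem flag_eq_zero_of_notMem (hx : x ∉ nearStrip v w) (s : ℝ) : flag v w s x = 0 := by
  have hmem : innerAt v w x ∉ Ioo 0 (innerAt v w w / 2) := fun h => hx ⟨h.1, by linarith [h.2]⟩
  rw [flag, flagDensity, indicator_of_notMem hmem]

/-- The parameter of the point at which the line through `v` and `x` meets the perpendicular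
bisector of `v` and `w`, in units of `|w - v|` from the midpoint of `[v, w]`. -/
def rayParam (v w x : Plane) : ℝ := crossAt v w x / (2 * innerAt v w x)

theorem flag_eq_of_mem (hx : x ∈ nearStrip v w) (s : ℝ) :
    flag v w s x = dist x v ^ 2 * signedInterval s (rayParam v w x) := by
  obtain ⟨hpos, hnear⟩ := hx
  have hww : innerAt v w w ≠ 0 := by linarith
  have hmem : innerAt v w x ∈ Ioo 0 (innerAt v w w / 2) := ⟨hpos, by linarith⟩
  rw [flag, flagDensity, indicator_of_mem hmem, ← innerAt_self,
    innerAt_sq_add_crossAt_sq, mul_div_cancel_left₀ _ hww, mul_comm, rayParam]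

end Flag

section Triple

/-- The parameter of the circumcentre of `v w u` on the perpendicular bisector of `v` and `w`, in
units of `|w - v|` from the midpoint of `[v, w]`. -/
def centerParam (v w u : Plane) : ℝ := innerAt u v w / 2 / crossAt v w u

theorem centerParam_swap (v w u : Plane) : centerParam w v u = -centerParam v w u := by
  rw [centerParam, crossAt_swap, innerAt_comm, div_neg, centerParam]

/-- The point with parameter `s` on the perpendicular bisector of `v` and `w`. -/
def bisectorPoint (v w : Plane) (s : ℝ) : Plane :=
  !₂[(v 0 + w 0) / 2 - s * (w 1 - v 1), (v 1 + w 1) / 2 + s * (w 0 - v 0)]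

theorem dist_sq_bisectorPoint (v w p : Plane) (s : ℝ) :
    dist p (bisectorPoint v w s) ^ 2
      = dist v (bisectorPoint v w s) ^ 2 + 2 * (innerAt p v w / 2 - crossAt v w p * s) := by
  simp only [← innerAt_self, innerAt_eq_coord, crossAt, bisectorPoint, Matrix.cons_val_zero,
    Matrix.cons_val_one]
  ring

theorem dist_bisectorPoint_centerParam {v w u p : Plane} (hu : crossAt v w u ≠ 0)
    (hp : innerAt p v w * crossAt v w u = crossAt v w p * innerAt u v w) :
    dist p (bisectorPoint v w (centerParam v w u))
      = dist v (bisectorPoint v w (centerParam v w u)) := by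
  rw [← sq_eq_sq₀ dist_nonneg dist_nonneg, dist_sq_bisectorPoint, centerParam, add_eq_left]
  field_simp
  linarith

/-- The parameters of the points on the perpendicular bisector of `v` and `w` that are centres of
circles through `v` and `w` enclosing no point of `S`. -/
def emptyCenters (S : Finset Plane) (v w : Plane) : Set ℝ :=
  linePolyhedron S (crossAt v w) fun p => innerAt p v w / 2

variable {S : Finset Plane} {v w u u' x : Plane}

theorem mem_emptyCenters_iff_dist {s : ℝ} :
    s ∈ emptyCenters S v w ↔
      ∀ p ∈ S, dist v (bisectorPoint v w s) ≤ dist p (bisectorPoint v w s) := by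
  refine forall₂_congr fun p _ => ?_
  rw [← sq_le_sq₀ dist_nonneg dist_nonneg, dist_sq_bisectorPoint v w p, le_add_iff_nonneg_right,
    mul_nonneg_iff_of_pos_left two_pos, sub_nonneg]

theorem emptyCenters_swap (S : Finset Plane) (v w : Plane) :
    emptyCenters S w v = -emptyCenters S v w := by
  have hcross : crossAt w v = -crossAt v w := funext fun p => crossAt_swap v w p
  simp only [emptyCenters, hcross, innerAt_comm _ w v, linePolyhedron_neg]

/-- `v w u` is a positively oriented triangle with vertices in `S` whose circumcircle encloses no
point of `S`. -/
structure DelaunayTriple (S : Finset Plane) (v w u : Plane) : Prop where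
  left_mem : v ∈ S
  mid_mem : w ∈ S
  right_mem : u ∈ S
  crossAt_pos : 0 < crossAt v w u
  centerParam_mem : centerParam v w u ∈ emptyCenters S v w

namespace DelaunayTriple

theorem crossAt_mul_innerAt_le (h : DelaunayTriple S v w u) {p : Plane} (hp : p ∈ S) :
    crossAt v w p * innerAt u v w ≤ innerAt p v w * crossAt v w u := by
  have hle := h.centerParam_mem p hp
  rw [centerParam, ← mul_div_assoc, div_le_iff₀ h.crossAt_pos] at hle
  linarith

theorem of_crossAt_mul_innerAt_le (hv : v ∈ S) (hw : w ∈ S) (hu : u ∈ S)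
    (hpos : 0 < crossAt v w u)
    (hle : ∀ p ∈ S, crossAt v w p * innerAt u v w ≤ innerAt p v w * crossAt v w u) :
    DelaunayTriple S v w u := by
  refine ⟨hv, hw, hu, hpos, fun p hp => ?_⟩
  rw [centerParam, ← mul_div_assoc, div_le_iff₀ hpos]
  linarith [hle p hp]

theorem rotate (h : DelaunayTriple S v w u) : DelaunayTriple S w u v := by
  refine of_crossAt_mul_innerAt_le h.mid_mem h.right_mem h.left_mem
    (crossAt_rotate v w u ▸ h.crossAt_pos) fun p hp => ?_
  have hid : innerAt p w u * crossAt w u v - crossAt w u p * innerAt v w u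
      = innerAt p v w * crossAt v w u - crossAt v w p * innerAt u v w := by
    simp only [innerAt_eq_coord, crossAt]
    ring
  linarith [h.crossAt_mul_innerAt_le hp]

theorem mid_ne_left (h : DelaunayTriple S v w u) : w ≠ v := by
  rintro rfl
  simpa [crossAt] using h.crossAt_pos

theorem eq_of_generalPosition (hgen : GeneralPosition S) (h : DelaunayTriple S v w u)
    (h' : DelaunayTriple S v w u') : u = u' := by
  classical
  by_contra hne
  have hcard : ({v, w, u, u'} : Finset Plane).card = 4 := by
    simp [hne, h.mid_ne_left.symm, h.rotate.mid_ne_left.symm,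
      h.rotate.rotate.mid_ne_left, h'.rotate.mid_ne_left.symm, h'.rotate.rotate.mid_ne_left]
  have hsubset : {v, w, u, u'} ⊆ S := by
    simp [Finset.insert_subset_iff, h.left_mem, h.mid_mem, h.right_mem, h'.right_mem]
  refine hgen _ hsubset hcard ⟨bisectorPoint v w (centerParam v w u), _, fun p hp =>
    dist_bisectorPoint_centerParam h.crossAt_pos.ne' ?_⟩
  simp only [Finset.coe_insert, Finset.coe_singleton, mem_insert_iff, mem_singleton_iff] at hp
  obtain rfl | rfl | rfl | rfl := hp
  · simp
  · simp
  · exact mul_comm _ _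
  · exact le_antisymm (by linarith [h'.crossAt_mul_innerAt_le h.right_mem])
      (h.crossAt_mul_innerAt_le h'.right_mem)

end DelaunayTriple

theorem delaunayTriple_iff (hv : v ∈ S) (hw : w ∈ S) (hu : u ∈ S) :
    DelaunayTriple S v w u ↔ 0 < crossAt v w u ∧ centerParam v w u ∈ emptyCenters S v w :=
  ⟨fun h => ⟨h.crossAt_pos, h.centerParam_mem⟩, fun h => ⟨hv, hw, hu, h.1, h.2⟩⟩

theorem delaunayTriple_swap_iff (hv : v ∈ S) (hw : w ∈ S) (hu : u ∈ S) :
    DelaunayTriple S w v u ↔ crossAt v w u < 0 ∧ centerParam v w u ∈ emptyCenters S v w := by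
  rw [delaunayTriple_iff hw hv hu, crossAt_swap, centerParam_swap, emptyCenters_swap, neg_mem_neg,
    Left.neg_pos_iff]

theorem innerAt_mul_sub_crossAt_mul_eq (v w x p : Plane) :
    innerAt p v w * innerAt v w x - crossAt v w p * crossAt v w x
      = innerAt v w x * innerAt v p p - innerAt v p x * innerAt v w w := by
  simp only [innerAt_eq_coord, crossAt]
  ring

theorem mem_exitCell_iff_rayParam_mem (hx : x ∈ nearStrip v w) :
    x ∈ exitCell (S : Set Plane) v w ↔ rayParam v w x ∈ emptyCenters S v w := by
  have hpos : 0 < innerAt v w x := hx.1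
  refine (and_iff_right hx).trans (forall₂_congr fun p _ => ?_)
  have hid := innerAt_mul_sub_crossAt_mul_eq v w x p
  rw [rayParam, ← mul_div_assoc, div_le_iff₀ (by linarith)]
  constructor <;> intro h <;> linarith

theorem mem_faceCell_iff_rayParam (hv : v ∈ S) (hw : w ∈ S) (hx : x ∈ nearStrip v w) :
    x ∈ faceCell (S : Set Plane) v w ↔
      0 < rayParam v w x ∧ emptyCenters S v w ∈ Filter.atTop ∨
        rayParam v w x < 0 ∧ emptyCenters S v w ∈ Filter.atBot := by
  have hpos : 0 < 2 * innerAt v w x := by linarith [hx.1]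
  rw [mem_faceCell_iff (Finset.mem_coe.mpr hv) (Finset.mem_coe.mpr hw), and_iff_right hx,
    emptyCenters, linePolyhedron_mem_atTop, linePolyhedron_mem_atBot, rayParam, div_pos_iff,
    div_neg_iff]
  simp only [hpos, hpos.not_gt, and_true, and_false, or_false, false_or]
  have hhalf (p : Plane) : 0 ≤ innerAt p v w / 2 ↔ 0 ≤ innerAt p v w := by
    constructor <;> intro h <;> linarith
  obtain hx | hx | hx := lt_trichotomy (crossAt v w x) 0
  · simp [hhalf, hx, hx.ne, hx.not_gt, hx.le, mul_nonpos_iff, hx.not_ge]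
  · simp [hx]
  · simp [hhalf, hx, hx.ne', hx.not_gt, mul_nonpos_iff, hx.le, hx.not_ge]

theorem Generic.rayParam_ne_centerParam (hx : Generic (S : Set Plane) x) (hv : v ∈ S) (hw : w ∈ S)
    (hu : u ∈ S) (hwx : innerAt v w x ≠ 0) (hcross : crossAt v w u ≠ 0) :
    rayParam v w x ≠ centerParam v w u := by
  intro h
  have hwv : w ≠ v := by
    rintro rfl
    simp [crossAt] at hcross
  have huv : u ≠ v := by
    rintro rfl
    exact hcross (crossAt_base_right u w)
  have huw : u ≠ w := by
    rintro rfl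
    exact hcross (crossAt_self v u)
  have hmul : crossAt v w x * (2 * crossAt v w u) = innerAt u v w * (2 * innerAt v w x) := by
    rwa [rayParam, centerParam, div_div, div_eq_div_iff (by simpa) (by simpa)] at h
  exact hx.bisectors_ne v hv w hw u hu hwv huv huw
    (by linarith [innerAt_mul_sub_crossAt_mul_eq v w x u])

/-- The squared distance to the nearer of `v` and `w` on the signed isosceles triangle with base
`[v, w]` and apex the circumcentre of `v w u`; the two flags with the same apex, seen from `v` and
from `w`, enter with opposite orientations. -/
def edgeDensity (v w u x : Plane) : ℝ :=
  flag v w (centerParam v w u) x - flag w v (centerParam w v u) x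

/-- The contribution of the edge from `v` to `w` to the Voronoi functional of the triangle
`v w u`. -/
def edgeTerm (v w u : Plane) : ℝ :=
  innerAt v w w ^ 2 / 16 * (centerParam v w u + 4 * centerParam v w u ^ 3 / 3)

theorem integrable_edgeDensity (hwv : w ≠ v) (u : Plane) : Integrable (edgeDensity v w u) :=
  (integrable_flag hwv _).sub (integrable_flag hwv.symm _)

theorem integral_edgeDensity (hwv : w ≠ v) (u : Plane) :
    ∫ x, edgeDensity v w u x = edgeTerm v w u := by
  have hbase : innerAt w v v = innerAt v w w := by rw [innerAt_self, innerAt_self, dist_comm]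
  unfold edgeDensity
  rw [integral_sub (integrable_flag hwv _) (integrable_flag hwv.symm _), integral_flag hwv,
    integral_flag hwv.symm, centerParam_swap v w u, hbase, edgeTerm]
  ring

open Classical in
/-- The positively oriented Delaunay triangles of `S`; each triangle occurs with the three cyclic
orders of its vertices. -/
def delaunayTriples (S : Finset Plane) : Finset (Plane × Plane × Plane) :=
  {τ ∈ S ×ˢ S ×ˢ S | DelaunayTriple S τ.1 τ.2.1 τ.2.2}

theorem mem_delaunayTriples : (v, w, u) ∈ delaunayTriples S ↔ DelaunayTriple S v w u := by
  simp only [delaunayTriples, Finset.mem_filter, Finset.mem_product, and_iff_right_iff_imp]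
  exact fun h => ⟨h.left_mem, h.mid_mem, h.right_mem⟩

open Classical in
theorem Generic.dist_sq_mul_indicator_exitCell_sub_faceCell (hgen : GeneralPosition S)
    (hx : Generic (S : Set Plane) x) (hv : v ∈ S) (hw : w ∈ S)
    (hcross : w ≠ v → crossAt v w x ≠ 0) :
    dist x v ^ 2 * ((exitCell (S : Set Plane) v w).indicator 1 x
        - (faceCell (S : Set Plane) v w).indicator 1 x)
      = ∑ u ∈ S with DelaunayTriple S v w u, flag v w (centerParam v w u) x
        - ∑ u ∈ S with DelaunayTriple S w v u, flag v w (centerParam v w u) x := by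
  by_cases hstrip : x ∈ nearStrip v w
  swap
  · have hexit : x ∉ exitCell (S : Set Plane) v w := fun h => hstrip h.1
    have hface : x ∉ faceCell (S : Set Plane) v w := fun h => hstrip h.1
    simp [hexit, hface, flag_eq_zero_of_notMem hstrip]
  have hpos : 0 < innerAt v w x := hstrip.1
  have hww : 0 < innerAt v w w := hpos.trans (by linarith [hstrip.2])
  have hwv : w ≠ v := innerAt_self_pos.mp hww
  have hparam : rayParam v w x ≠ 0 := div_ne_zero (hcross hwv) (by linarith)
  have hvertex : ∀ u ∈ S, crossAt v w u < 0 → rayParam v w x ≠ centerParam v w u :=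
    fun u hu hneg => hx.rayParam_ne_centerParam hv hw hu hpos.ne' hneg.ne
  have hline := indicator_linePolyhedron_sub_ite (J := S) (β := crossAt v w)
    (γ := fun p => innerAt p v w / 2)
    (fun i hi j hj hβi hβj hmi hmj => DelaunayTriple.eq_of_generalPosition hgen
      ((delaunayTriple_iff hv hw hi).mpr ⟨hβi, hmi⟩) ((delaunayTriple_iff hv hw hj).mpr ⟨hβj, hmj⟩))
    (fun i hi j hj hβi hβj hmi hmj => DelaunayTriple.eq_of_generalPosition hgen
      ((delaunayTriple_swap_iff hv hw hi).mpr ⟨hβi, hmi⟩)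
      ((delaunayTriple_swap_iff hv hw hj).mpr ⟨hβj, hmj⟩)) hparam hvertex
  simp only [flag_eq_of_mem hstrip, ← Finset.mul_sum, ← mul_sub]
  rw [Finset.filter_congr fun u hu => delaunayTriple_iff hv hw hu,
    Finset.filter_congr fun u hu => delaunayTriple_swap_iff hv hw hu]
  refine congrArg (dist x v ^ 2 * ·) (Eq.trans ?_ hline)
  simp only [indicator, mem_exitCell_iff_rayParam_mem hstrip,
    mem_faceCell_iff_rayParam hv hw hstrip,
    emptyCenters, Pi.one_apply]

theorem Generic.cellIntegrand_eq_sum_edgeDensity (hgen : GeneralPosition S)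
    (hx : Generic (S : Set Plane) x) (hcross : ∀ v ∈ S, ∀ w ∈ S, w ≠ v → crossAt v w x ≠ 0)
    (hne : S.Nonempty) {N NV : Plane → Plane} (hN : IsNearest (S : Set Plane) x (N x))
    (hNV : x ∉ hull S → IsNearest (visibleVertices S x) x (NV x)) :
    cellIntegrand S N NV x = ∑ τ ∈ delaunayTriples S, edgeDensity τ.1 τ.2.1 τ.2.2 x := by
  classical
  have hpair : cellIntegrand S N NV x = ∑ v ∈ S, ∑ w ∈ S,
      (∑ u ∈ S with DelaunayTriple S v w u, flag v w (centerParam v w u) x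
        - ∑ u ∈ S with DelaunayTriple S w v u, flag v w (centerParam v w u) x) := by
    rw [hx.cellIntegrand_eq_sum hne hN hNV]
    exact Finset.sum_congr rfl fun v hv => Finset.sum_congr rfl fun w hw =>
      hx.dist_sq_mul_indicator_exitCell_sub_faceCell hgen hv hw (hcross v hv w hw)
  simp only [hpair, Finset.sum_sub_distrib]
  rw [Finset.sum_comm (f := fun v w => ∑ u ∈ S with DelaunayTriple S w v u,
    flag v w (centerParam v w u) x)]
  simp only [← Finset.sum_sub_distrib, delaunayTriples, edgeDensity, Finset.sum_filter,
    Finset.sum_product, ite_sub_ite, sub_zero]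

theorem cellIntegrand_ae_eq_sum_edgeDensity (hgen : GeneralPosition S) (hne : S.Nonempty)
    {N NV : Plane → Plane} (hN : ∀ x, IsNearest (S : Set Plane) x (N x))
    (hNV : ∀ x, x ∉ hull S → IsNearest (visibleVertices S x) x (NV x)) :
    cellIntegrand S N NV =ᵐ[volume]
      fun x => ∑ τ ∈ delaunayTriples S, edgeDensity τ.1 τ.2.1 τ.2.2 x := by
  have hS : (S : Set Plane).Countable := S.countable_toSet
  have hcross : ∀ᵐ x : Plane, ∀ v ∈ (S : Set Plane), ∀ w ∈ (S : Set Plane),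
      w ≠ v → crossAt v w x ≠ 0 := by
    simp only [ae_ball_iff hS, Filter.eventually_imp_distrib_left]
    exact fun v _ w _ => ae_crossAt_ne
  filter_upwards [ae_generic volume hS, hcross] with x hx hxc
  exact hx.cellIntegrand_eq_sum_edgeDensity hgen hxc hne (hN x) (hNV x)

theorem integrable_cellIntegrand (hne : S.Nonempty) (hgen : GeneralPosition S)
    {N NV : Plane → Plane} (hN : ∀ x, IsNearest (S : Set Plane) x (N x))
    (hNV : ∀ x, x ∉ hull S → IsNearest (visibleVertices S x) x (NV x)) :
    Integrable (cellIntegrand S N NV) :=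
  (integrable_congr (cellIntegrand_ae_eq_sum_edgeDensity hgen hne hN hNV)).mpr
    (integrable_finsetSum _ fun _ hτ => integrable_edgeDensity
      (mem_delaunayTriples.mp hτ).mid_ne_left _)

theorem integral_cellIntegrand_eq_sum_edgeTerm (hne : S.Nonempty) (hgen : GeneralPosition S)
    {N NV : Plane → Plane} (hN : ∀ x, IsNearest (S : Set Plane) x (N x))
    (hNV : ∀ x, x ∉ hull S → IsNearest (visibleVertices S x) x (NV x)) :
    ∫ x, cellIntegrand S N NV x = ∑ τ ∈ delaunayTriples S, edgeTerm τ.1 τ.2.1 τ.2.2 := by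
  rw [integral_congr_ae (cellIntegrand_ae_eq_sum_edgeDensity hgen hne hN hNV),
    integral_finsetSum _ fun _ hτ => integrable_edgeDensity
      (mem_delaunayTriples.mp hτ).mid_ne_left _]
  exact Finset.sum_congr rfl fun _ hτ => integral_edgeDensity
    (mem_delaunayTriples.mp hτ).mid_ne_left _

end Triple

section Triangle

theorem collinear_iff_crossAt_eq_zero {v w u : Plane} (hwv : w ≠ v) :
    Collinear ℝ {v, w, u} ↔ crossAt v w u = 0 := by
  refine ⟨fun h => ?_, fun h => ?_⟩
  · have hu : u ∈ line[ℝ, v, w] :=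
      h.mem_affineSpan_of_mem_of_ne (by simp) (by simp) (by simp) hwv.symm
    obtain ⟨r, rfl⟩ := mem_affineSpan_pair_iff_exists_lineMap_eq.mp hu
    exact crossAt_lineMap v w r
  · obtain ⟨r, rfl⟩ := exists_eq_lineMap_of_crossAt_eq_zero hwv h
    have hcol := collinear_insert_of_mem_affineSpan_pair
      (AffineMap.lineMap_mem_affineSpan_pair r v w)
    convert hcol using 1
    aesop

theorem affineIndependent_iff_crossAt_ne_zero {v w u : Plane} :
    AffineIndependent ℝ ![v, w, u] ↔ crossAt v w u ≠ 0 := by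
  rw [affineIndependent_iff_not_collinear_set]
  obtain rfl | hwv := eq_or_ne w v
  · refine iff_of_false (not_not_intro ?_) (not_not_intro (by simp [crossAt]))
    simpa using collinear_pair ℝ w u
  · exact (collinear_iff_crossAt_eq_zero hwv).not

/-- The triangle with vertices `v`, `w`, `u`. -/
def mkTriangle (v w u : Plane) (h : crossAt v w u ≠ 0) : Affine.Triangle ℝ Plane :=
  ⟨![v, w, u], affineIndependent_iff_crossAt_ne_zero.mpr h⟩

theorem range_points_mkTriangle {v w u : Plane} (h : crossAt v w u ≠ 0) :
    range (mkTriangle v w u h).points = {v, w, u} := by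
  simp only [mkTriangle, Matrix.range_cons, Matrix.range_empty, singleton_union, insert_empty_eq]

theorem exists_crossAt_pos_range_points_eq (T : Affine.Triangle ℝ Plane) :
    ∃ v w u, 0 < crossAt v w u ∧ range T.points = {v, w, u} := by
  have hpoints : T.points = ![T.points 0, T.points 1, T.points 2] := by
    funext i
    fin_cases i <;> rfl
  have hrange : range T.points = {T.points 0, T.points 1, T.points 2} := by
    rw [hpoints]
    simp only [Matrix.range_cons, Matrix.range_empty, singleton_union, insert_empty_eq,
      Matrix.cons_val_zero, Matrix.cons_val_one, Matrix.cons_val]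
  have hind := T.independent
  rw [hpoints, affineIndependent_iff_crossAt_ne_zero] at hind
  obtain h | h := hind.lt_or_gt
  · refine ⟨T.points 1, T.points 0, T.points 2, ?_, hrange.trans (insert_comm _ _ _)⟩
    rwa [crossAt_swap, neg_pos]
  · exact ⟨_, _, _, h, hrange⟩

variable {S t : Finset Plane} {T : Affine.Triangle ℝ Plane} {v w u : Plane}

theorem bisectorPoint_centerParam_eq (h : crossAt v w u ≠ 0) (hT : range T.points = {v, w, u}) :
    bisectorPoint v w (centerParam v w u) = T.circumcenter ∧
      dist v (bisectorPoint v w (centerParam v w u)) = T.circumradius := by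
  have htop : affineSpan ℝ (range T.points) = ⊤ := by
    rw [T.independent.affineSpan_eq_top_iff_card_eq_finrank_add_one]
    simp
  have hdist (i) : dist (T.points i) (bisectorPoint v w (centerParam v w u))
      = dist v (bisectorPoint v w (centerParam v w u)) := by
    refine dist_bisectorPoint_centerParam h ?_
    have hi : T.points i ∈ ({v, w, u} : Set Plane) := hT ▸ mem_range_self i
    obtain hi | hi | hi : T.points i = v ∨ T.points i = w ∨ T.points i = u := hi <;>
      simp [hi, mul_comm]
  have hmem : bisectorPoint v w (centerParam v w u) ∈ affineSpan ℝ (range T.points) :=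
    htop ▸ AffineSubspace.mem_top ..
  exact ⟨T.eq_circumcenter_of_dist_eq hmem hdist, T.eq_circumradius_of_dist_eq hmem hdist⟩

theorem isDelaunay_iff (h : 0 < crossAt v w u) (hT : range T.points = {v, w, u}) :
    IsDelaunay S T ↔ DelaunayTriple S v w u := by
  obtain ⟨hcenter, hradius⟩ := bisectorPoint_centerParam_eq h.ne' hT
  have hvertices : (∀ i, T.points i ∈ S) ↔ v ∈ S ∧ w ∈ S ∧ u ∈ S := by
    simpa [hT] using (forall_mem_range (f := T.points) (p := (· ∈ S))).symm
  rw [IsDelaunay, hvertices, ← hcenter, ← hradius, ← mem_emptyCenters_iff_dist]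
  exact ⟨fun ⟨⟨hv, hw, hu⟩, hempty⟩ => ⟨hv, hw, hu, h, hempty⟩,
    fun hD => ⟨⟨hD.left_mem, hD.mid_mem, hD.right_mem⟩, hD.centerParam_mem⟩⟩

theorem mem_delaunay_iff :
    t ∈ delaunay S ↔ ∃ v w u, DelaunayTriple S v w u ∧ (t : Set Plane) = {v, w, u} := by
  simp only [delaunay, Finset.mem_filter, Finset.mem_powerset]
  constructor
  · rintro ⟨-, T, hT, hrange⟩
    obtain ⟨v, w, u, hpos, hvwu⟩ := exists_crossAt_pos_range_points_eq T
    exact ⟨v, w, u, (isDelaunay_iff hpos hvwu).mp hT, hrange.symm.trans hvwu⟩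
  · rintro ⟨v, w, u, h, ht⟩
    refine ⟨?_, mkTriangle v w u h.crossAt_pos.ne',
      (isDelaunay_iff h.crossAt_pos (range_points_mkTriangle _)).mpr h,
      (range_points_mkTriangle _).trans ht.symm⟩
    rw [← Finset.coe_subset, ht]
    simp [insert_subset_iff, h.left_mem, h.mid_mem, h.right_mem]

end Triangle

section Nearest

variable {S : Finset Plane} {x : Plane}

theorem exists_isNearest (hne : S.Nonempty) (x : Plane) : ∃ p, IsNearest (S : Set Plane) x p :=
  S.exists_min_image (dist x) hne

theorem visibleVertices_nonempty (hne : S.Nonempty) (hx : x ∉ hull S) :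
    (visibleVertices S x).Nonempty := by
  obtain ⟨q, hq, hxq⟩ := exists_mem_convexHull_mem_normalCone S.finite_toSet hne x
  have hface : q ∈ convexHull ℝ {p ∈ (S : Set Plane) | innerAt q x p = 0} :=
    mem_convexHull_face hq fun p hp => (innerAt_comm q x p).trans_le (hxq p hp)
  obtain ⟨v, hv, hqv⟩ := convexHull_nonempty_iff.mp ⟨q, hface⟩
  exact ⟨v, mem_visibleVertices hxq (fun h => hx (h ▸ hq)) hv hqv⟩

theorem exists_isNearest_visible (hne : S.Nonempty) (hx : x ∉ hull S) :
    ∃ p, IsNearest (visibleVertices S x) x p :=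
  exists_min_image _ (dist x) (S.finite_toSet.subset fun _ hv => hv.1.1)
    (visibleVertices_nonempty hne hx)

end Nearest

section Acute

variable {S : Finset Plane} {v w u x : Plane}

theorem innerAt_pos_of_angle_lt (h : ∠ v u w < Real.pi / 2) : 0 < innerAt u v w := by
  rw [angle, InnerProductGeometry.angle, Real.arccos_lt_pi_div_two] at h
  rw [div_eq_mul_inv] at h
  exact pos_of_mul_pos_left h (by positivity)

theorem DelaunayTriple.innerAt_pos_of_acute (h : DelaunayTriple S v w u)
    (hacute : HullOppositeAnglesAcute S) (hedge : segment ℝ v w ⊆ frontier (hull S)) :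
    0 < innerAt u v w :=
  innerAt_pos_of_angle_lt <|
    hacute (mkTriangle v w u h.crossAt_pos.ne')
      ((isDelaunay_iff h.crossAt_pos (range_points_mkTriangle _)).mpr h) 0 1 2
      (by decide) (by decide) (by decide) hedge

/-- The largest empty centre on a hull edge is the circumcentre of the Delaunay triangle on it;
when that centre lies on the inner side, so that the triangle is acute there, the midpoint of the
edge is an empty centre as well. -/
theorem zero_mem_emptyCenters_of_mem_atBot (hv : v ∈ S) (hw : w ∈ S)
    (hacute : ∀ u, DelaunayTriple S v w u → 0 < innerAt u v w)
    (hbot : emptyCenters S v w ∈ Filter.atBot) : 0 ∈ emptyCenters S v w := by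
  obtain ⟨t, ht, ht₀⟩ := (Filter.eventually_mem_set.mpr hbot |>.and
    (Filter.eventually_le_atBot 0)).exists
  by_cases hcross : ∃ k ∈ S, 0 < crossAt v w k
  · obtain ⟨k, hk, hpos⟩ := hcross
    obtain ⟨u, hu, hupos, hmem⟩ := exists_mem_linePolyhedron_of_pos ⟨t, ht⟩ hk hpos
    have hinner := hacute u ⟨hv, hw, hu, hupos, hmem⟩
    exact ordConnected_linePolyhedron.out ht hmem ⟨ht₀, by positivity⟩
  · push Not at hcross
    intro p hp
    exact (mul_le_mul_of_nonpos_left ht₀ (hcross p hp)).trans (ht p hp)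

theorem zero_mem_emptyCenters_of_mem_atTop (hv : v ∈ S) (hw : w ∈ S)
    (hacute : ∀ u, DelaunayTriple S w v u → 0 < innerAt u w v)
    (htop : emptyCenters S v w ∈ Filter.atTop) : 0 ∈ emptyCenters S v w := by
  have hswap := emptyCenters_swap S w v
  rw [hswap, emptyCenters, neg_linePolyhedron_mem_atTop] at htop
  rw [hswap, mem_neg, neg_zero]
  exact zero_mem_emptyCenters_of_mem_atBot hw hv hacute htop

theorem faceCell_subset_exitCell_of_acute (hacute : HullOppositeAnglesAcute S) (hv : v ∈ S)
    (hw : w ∈ S) : faceCell (S : Set Plane) v w ⊆ exitCell (S : Set Plane) v w := by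
  intro x hx
  have hedge := segment_subset_frontier_of_mem_faceCell hv hw hx
  rw [mem_exitCell_iff_rayParam_mem hx.1]
  obtain ⟨hpos, htop⟩ | ⟨hneg, hbot⟩ := (mem_faceCell_iff_rayParam hv hw hx.1).mp hx
  · obtain ⟨t, ht, hle⟩ := (Filter.eventually_mem_set.mpr htop |>.and
      (Filter.eventually_ge_atTop (rayParam v w x))).exists
    have hzero := zero_mem_emptyCenters_of_mem_atTop hv hw
      (fun u hD => hD.innerAt_pos_of_acute hacute (segment_symm ℝ v w ▸ hedge)) htop
    exact ordConnected_linePolyhedron.out hzero ht ⟨hpos.le, hle⟩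
  · obtain ⟨t, ht, hle⟩ := (Filter.eventually_mem_set.mpr hbot |>.and
      (Filter.eventually_le_atBot (rayParam v w x))).exists
    have hzero := zero_mem_emptyCenters_of_mem_atBot hv hw
      (fun u hD => hD.innerAt_pos_of_acute hacute hedge) hbot
    exact ordConnected_linePolyhedron.out ht hzero ⟨hle, hneg.le⟩

theorem visibleCell_subset_voronoiCell_of_acute (hacute : HullOppositeAnglesAcute S) (hv : v ∈ S) :
    visibleCell (S : Set Plane) v ⊆ voronoiCell (S : Set Plane) v :=
  union_subset normalCone_subset_voronoiCell <| iUnion₂_subset fun _ hw =>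
    (faceCell_subset_exitCell_of_acute hacute hv hw).trans exitCell_subset_voronoiCell

theorem Generic.dist_eq_of_acute (hx : Generic (S : Set Plane) x) (hne : S.Nonempty)
    (hacute : HullOppositeAnglesAcute S) (hxS : x ∉ hull S) {n m : Plane}
    (hn : IsNearest (S : Set Plane) x n) (hm : IsNearest (visibleVertices S x) x m) :
    dist x n = dist x m := by
  obtain ⟨v, hv, hxv⟩ := hx.exists_mem_visibleCell hne hxS
  have hvis := isNearest_visibleVertices_of_mem_visibleCell hv hxv hxS
  have hvor := visibleCell_subset_voronoiCell_of_acute hacute hv hxv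
  exact le_antisymm (hn.2 m hm.1.1.1) ((hm.2 v hvis.1).trans (hvor n hn.1))

theorem measurableSet_hull (S : Finset Plane) : MeasurableSet (hull S) :=
  (S.finite_toSet.isCompact_convexHull ℝ).isClosed.measurableSet

theorem integral_cellIntegrand_of_acute (hne : S.Nonempty) (hacute : HullOppositeAnglesAcute S)
    {N NV : Plane → Plane} (hN : ∀ x, IsNearest (S : Set Plane) x (N x))
    (hNV : ∀ x, x ∉ hull S → IsNearest (visibleVertices S x) x (NV x)) :
    ∫ x, cellIntegrand S N NV x = ∫ x in hull S, dist x (N x) ^ 2 := by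
  rw [← integral_indicator (measurableSet_hull S)]
  refine integral_congr_ae ?_
  filter_upwards [ae_generic volume S.countable_toSet] with x hx
  by_cases hxS : x ∈ hull S
  · rw [cellIntegrand, if_pos hxS, indicator_of_mem hxS, sub_zero]
  · rw [cellIntegrand, if_neg hxS, indicator_of_notMem hxS,
      hx.dist_eq_of_acute hne hacute hxS (hN x) (hNV x hxS), sub_self]

end Acute

section Area

theorem measurableSet_rightTriangle (K : ℝ) :
    MeasurableSet {y : ℝ × ℝ | 0 ≤ y.1 ∧ 0 ≤ y.2 ∧ y.1 + y.2 ≤ K} := by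
  measurability

theorem volume_rightTriangle {K : ℝ} (hK : 0 ≤ K) :
    volume {y : ℝ × ℝ | 0 ≤ y.1 ∧ 0 ≤ y.2 ∧ y.1 + y.2 ≤ K} = ENNReal.ofReal (K ^ 2 / 2) := by
  have hslice (a : ℝ) : volume (Prod.mk a ⁻¹' {y : ℝ × ℝ | 0 ≤ y.1 ∧ 0 ≤ y.2 ∧ y.1 + y.2 ≤ K})
      = (Icc 0 K).indicator (fun a => ENNReal.ofReal (K - a)) a := by
    by_cases ha : a ∈ Icc 0 K
    · rw [indicator_of_mem ha, ← sub_zero (K - a), ← Real.volume_Icc]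
      congr 1
      ext b
      simp [ha.1, le_sub_iff_add_le']
    · rw [indicator_of_notMem ha, ← measure_empty (μ := (volume : Measure ℝ))]
      congr 1
      ext b
      simp only [mem_preimage, mem_ofPred_eq, mem_empty_iff_false, iff_false]
      exact fun ⟨ha₀, hb₀, hab⟩ => ha ⟨ha₀, by linarith [hb₀, hab]⟩
  have hint : IntegrableOn (fun a => K - a) (Icc 0 K) :=
    Continuous.integrableOn_Icc (by fun_prop)
  have hnonneg : ∀ᵐ a ∂volume.restrict (Icc 0 K), 0 ≤ K - a := by
    filter_upwards [ae_restrict_mem measurableSet_Icc] with a ha using sub_nonneg.mpr ha.2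
  have hvalue : ∫ a in (0 : ℝ)..K, (K - a) = K ^ 2 / 2 := by
    rw [intervalIntegral.integral_comp_sub_left fun a => a]
    simp
  rw [Measure.volume_eq_prod, Measure.prod_apply (measurableSet_rightTriangle K),
    lintegral_congr hslice, lintegral_indicator measurableSet_Icc,
    ← ofReal_integral_eq_lintegral_ofReal hint hnonneg, integral_Icc_eq_integral_Ioc,
    ← intervalIntegral.integral_of_le hK, hvalue]

variable {v w u x : Plane}

theorem crossAt_nonneg_of_mem_convexHull {s : Set Plane} (h : ∀ p ∈ s, 0 ≤ crossAt v w p)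
    (hx : x ∈ convexHull ℝ s) : 0 ≤ crossAt v w x := by
  rw [crossAt_eq_inner, ← neg_nonpos, ← inner_neg_left]
  refine inner_sub_nonpos_of_mem_convexHull (fun p hp => ?_) hx
  rw [inner_neg_left, neg_nonpos, ← crossAt_eq_inner]
  exact h p hp

theorem crossAt_add_crossAt_add_crossAt (v w u x : Plane) :
    crossAt w u x + crossAt u v x + crossAt v w x = crossAt v w u := by
  unfold crossAt
  ring

theorem crossAt_smul_eq_barycentric (v w u x : Plane) :
    crossAt v w u • x = crossAt w u x • v + crossAt u v x • w + crossAt v w x • u := by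
  ext i
  fin_cases i <;> simp [crossAt] <;> ring

theorem convexHull_triangle (h : 0 < crossAt v w u) :
    convexHull ℝ {v, w, u} = {x | 0 ≤ crossAt w u x ∧ 0 ≤ crossAt u v x ∧ 0 ≤ crossAt v w x} := by
  have h₂ : 0 < crossAt w u v := crossAt_rotate v w u ▸ h
  have h₃ : 0 < crossAt u v w := crossAt_rotate w u v ▸ h₂
  refine Subset.antisymm (fun x hx => ⟨?_, ?_, ?_⟩) ?_
  · exact crossAt_nonneg_of_mem_convexHull (by simp [h₂.le]) hx
  · exact crossAt_nonneg_of_mem_convexHull (by simp [h₃.le]) hx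
  · exact crossAt_nonneg_of_mem_convexHull (by simp [h.le]) hx
  · rintro x ⟨hv, hw, hu⟩
    have hx : Finset.univ.centerMass ![crossAt w u x, crossAt u v x, crossAt v w x] ![v, w, u]
        = x := by
      simp only [Finset.centerMass, Fin.sum_univ_three, Matrix.cons_val_zero, Matrix.cons_val_one,
        Matrix.cons_val, crossAt_add_crossAt_add_crossAt, ← crossAt_smul_eq_barycentric]
      exact inv_smul_smul₀ h.ne' x
    rw [← hx]
    refine Finset.centerMass_mem_convexHull _ (fun i _ => ?_) ?_ fun i _ => ?_
    · fin_cases i <;> assumption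
    · simpa [Fin.sum_univ_three, crossAt_add_crossAt_add_crossAt] using h
    · fin_cases i <;> simp

theorem volume_triangle (h : 0 < crossAt v w u) :
    volume.real (convexHull ℝ {v, w, u}) = crossAt v w u / 2 := by
  have hpre : convexHull ℝ {v, w, u} = (fun x : Plane => (crossAt u v x, crossAt v w x)) ⁻¹'
      {y : ℝ × ℝ | 0 ≤ y.1 ∧ 0 ≤ y.2 ∧ y.1 + y.2 ≤ crossAt v w u} := by
    rw [convexHull_triangle h]
    ext x
    have hsum := crossAt_add_crossAt_add_crossAt v w u x
    simp only [mem_ofPred_eq, mem_preimage]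
    constructor <;> rintro ⟨h₁, h₂, h₃⟩ <;> refine ⟨?_, ?_, ?_⟩ <;> linarith
  have hmeas : Measurable fun x : Plane => (crossAt u v x, crossAt v w x) := by
    unfold crossAt
    fun_prop
  rw [Measure.real, hpre, ← Measure.map_apply hmeas (measurableSet_rightTriangle _),
    map_crossAt_crossAt_volume h, Measure.smul_apply, volume_rightTriangle h.le, smul_eq_mul,
    ← ENNReal.ofReal_mul (by positivity), ENNReal.toReal_ofReal (by positivity)]
  field_simp

end Area

section Triangulation

variable {S : Finset Plane} {T : Affine.Triangle ℝ Plane} {v w u a b c : Plane}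

theorem crossAt_sq (v w u : Plane) :
    crossAt v w u ^ 2 = innerAt v w u * innerAt w u v + innerAt w u v * innerAt u v w
      + innerAt u v w * innerAt v w u := by
  simp only [innerAt_eq_coord, crossAt]
  ring

theorem dist_bisectorPoint_sq (v w : Plane) (s : ℝ) :
    dist v (bisectorPoint v w s) ^ 2 = innerAt v w w * (1 / 4 + s ^ 2) := by
  simp only [← innerAt_self, innerAt_eq_coord, bisectorPoint, Matrix.cons_val_zero,
    Matrix.cons_val_one]
  ring

theorem area_mul_sum_sq_sub_circumradius_sq (h : 0 < crossAt v w u) :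
    crossAt v w u / 2 / 12 * (dist w u ^ 2 + dist u v ^ 2 + dist v w ^ 2
        - 4 * dist v (bisectorPoint v w (centerParam v w u)) ^ 2)
      = edgeTerm v w u + edgeTerm w u v + edgeTerm u v w := by
  have hsq := crossAt_sq v w u
  rw [dist_bisectorPoint_sq, dist_comm w u, dist_comm u v, dist_comm v w, ← innerAt_self,
    ← innerAt_self, ← innerAt_self]
  simp only [edgeTerm, centerParam, crossAt_rotate, innerAt_self_eq_add v w u,
    innerAt_self_eq_add w u v, innerAt_self_eq_add u v w]
  generalize crossAt v w u = k at *
  generalize innerAt v w u = a at *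
  generalize innerAt w u v = b at *
  generalize innerAt u v w = c at *
  field_simp
  linear_combination 48 * (4 * (a + b + 2 * c) * (k ^ 2 + (a * b + b * c + c * a))
    - 4 * (a + b) * c ^ 2 - 3 * ((a + b) ^ 2 * c + (b + c) ^ 2 * a + (c + a) ^ 2 * b)) * hsq

theorem rotation_of_crossAt_pos (h : 0 < crossAt v w u) (h' : 0 < crossAt a b c)
    (hset : ({a, b, c} : Set Plane) = {v, w, u}) :
    (a, b, c) = (v, w, u) ∨ (a, b, c) = (w, u, v) ∨ (a, b, c) = (u, v, w) := by
  have ha : a ∈ ({v, w, u} : Set Plane) := hset ▸ (by simp)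
  have hb : b ∈ ({v, w, u} : Set Plane) := hset ▸ (by simp)
  have hc : c ∈ ({v, w, u} : Set Plane) := hset ▸ (by simp)
  clear hset
  simp only [mem_insert_iff, mem_singleton_iff] at ha hb hc
  rcases ha with ha | ha | ha <;> rcases hb with hb | hb | hb <;> rcases hc with hc | hc | hc <;>
    rw [ha, hb, hc] at h' ⊢ <;>
    first | (simp; done) | (unfold crossAt at h h'; linarith)

/-- The vertex set of the triangle given by an ordered triple of points. -/
def vertexSet (τ : Plane × Plane × Plane) : Finset Plane :=
  open Classical in {τ.1, τ.2.1, τ.2.2}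

theorem coe_vertexSet (v w u : Plane) : (vertexSet (v, w, u) : Set Plane) = {v, w, u} := by
  simp [vertexSet]

theorem DelaunayTriple.card_vertexSet (h : DelaunayTriple S v w u) :
    (vertexSet (v, w, u)).card = 3 := by
  simp [vertexSet, h.mid_ne_left.symm, h.rotate.mid_ne_left.symm, h.rotate.rotate.mid_ne_left]

theorem DelaunayTriple.of_vertexSet (h : 0 < crossAt v w u) :
    DelaunayTriple (vertexSet (v, w, u)) v w u := by
  refine .of_crossAt_mul_innerAt_le (by simp [vertexSet]) (by simp [vertexSet])
    (by simp [vertexSet]) h fun p hp => ?_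
  simp only [vertexSet, Finset.mem_insert, Finset.mem_singleton] at hp
  obtain rfl | rfl | rfl := hp <;> simp [mul_comm]

open Classical in
theorem sum_edgeTerm_with_vertexSet_eq (h : DelaunayTriple S v w u) :
    ∑ τ ∈ delaunayTriples S with vertexSet τ = vertexSet (v, w, u), edgeTerm τ.1 τ.2.1 τ.2.2
      = edgeTerm v w u + edgeTerm w u v + edgeTerm u v w := by
  have hfiber : {τ ∈ delaunayTriples S | vertexSet τ = vertexSet (v, w, u)}
      = {(v, w, u), (w, u, v), (u, v, w)} := by
    ext ⟨a, b, c⟩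
    simp only [Finset.mem_filter, mem_delaunayTriples, Finset.mem_insert, Finset.mem_singleton,
      ← Finset.coe_inj, coe_vertexSet]
    refine ⟨fun ⟨h', hset⟩ => rotation_of_crossAt_pos h.crossAt_pos h'.crossAt_pos hset, ?_⟩
    simp only [Prod.mk.injEq]
    rintro (⟨rfl, rfl, rfl⟩ | ⟨rfl, rfl, rfl⟩ | ⟨rfl, rfl, rfl⟩)
    · exact ⟨h, rfl⟩
    · exact ⟨h.rotate, by grind⟩
    · exact ⟨h.rotate.rotate, by grind⟩
  rw [hfiber, Finset.sum_insert, Finset.sum_insert, Finset.sum_singleton, add_assoc]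
  · simp [h.rotate.rotate.mid_ne_left.symm]
  · simp [h.mid_ne_left.symm, h.rotate.rotate.mid_ne_left]

theorem sum_delaunayTriples_vertexSet (h : 0 < crossAt v w u) :
    ∑ τ ∈ delaunayTriples (vertexSet (v, w, u)), edgeTerm τ.1 τ.2.1 τ.2.2
      = edgeTerm v w u + edgeTerm w u v + edgeTerm u v w := by
  classical
  have htriple := DelaunayTriple.of_vertexSet h
  rw [← sum_edgeTerm_with_vertexSet_eq htriple, Finset.filter_true_of_mem]
  rintro ⟨a, b, c⟩ hτ
  have hτ := mem_delaunayTriples.mp hτ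
  refine Finset.eq_of_subset_of_card_le ?_ (by rw [hτ.card_vertexSet, htriple.card_vertexSet])
  rw [← Finset.coe_subset, coe_vertexSet a b c]
  simp [insert_subset_iff, hτ.left_mem, hτ.mid_mem, hτ.right_mem]

theorem generalPosition_of_card_le (hS : S.card ≤ 3) : GeneralPosition S := fun t ht hcard => by
  have := Finset.card_le_card ht
  omega

theorem hullOppositeAnglesAcute_of_acuteAngled (hT : T.AcuteAngled)
    (hrange : range T.points = (S : Set Plane)) : HullOppositeAnglesAcute S := by
  intro T' hT' i j k hij hik hjk _
  have hpoints (i) : ∃ i', T.points i' = T'.points i :=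
    mem_range.mp (hrange ▸ Finset.mem_coe.mpr (hT'.1 i))
  choose f hf using hpoints
  have hinj {i j} (hij : i ≠ j) : f i ≠ f j := fun h =>
    hij (T'.independent.injective (by rw [← hf, ← hf, h]))
  rw [← hf i, ← hf j, ← hf k]
  exact hT _ _ _ (hinj hik) (hinj hij) (hinj hjk.symm)

theorem infDist_eq_of_isNearest {A : Set Plane} {x p : Plane} (hp : IsNearest A x p) :
    Metric.infDist x A = dist x p :=
  le_antisymm (Metric.infDist_le_dist_of_mem hp.1)
    ((Metric.le_infDist ⟨p, hp.1⟩).mpr hp.2)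

theorem voronoiTriangle_of_acuteAngled (hT : T.AcuteAngled)
    (hrange : range T.points = (S : Set Plane)) {N : Plane → Plane}
    (hN : ∀ x, IsNearest (S : Set Plane) x (N x)) :
    voronoiTriangle T = ∫ x in hull S, dist x (N x) ^ 2 := by
  rw [voronoiTriangle, if_pos hT, body, hrange, ← hull]
  simp only [infDist_eq_of_isNearest (hN _)]

theorem voronoiTriangle_mkTriangle (h : 0 < crossAt v w u) :
    voronoiTriangle (mkTriangle v w u h.ne')
      = edgeTerm v w u + edgeTerm w u v + edgeTerm u v w := by
  have hrange := range_points_mkTriangle h.ne'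
  by_cases hT : (mkTriangle v w u h.ne').AcuteAngled
  · have htriple := DelaunayTriple.of_vertexSet h
    have hne : (vertexSet (v, w, u)).Nonempty := ⟨v, htriple.left_mem⟩
    have hgen := generalPosition_of_card_le htriple.card_vertexSet.le
    have hrange' := hrange.trans (coe_vertexSet v w u).symm
    choose N hN using exists_isNearest hne
    have hvisible (x) : x ∉ hull (vertexSet (v, w, u)) →
        ∃ p, IsNearest (visibleVertices (vertexSet (v, w, u)) x) x p :=
      exists_isNearest_visible hne
    choose! NV hNV using hvisible
    rw [voronoiTriangle_of_acuteAngled hT hrange' hN, ← integral_cellIntegrand_of_acute hne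
      (hullOppositeAnglesAcute_of_acuteAngled hT hrange') hN hNV,
      integral_cellIntegrand_eq_sum_edgeTerm hne hgen hN hNV, sum_delaunayTriples_vertexSet h]
  · rw [voronoiTriangle, if_neg hT, body, hrange, volume_triangle h,
      ← (bisectorPoint_centerParam_eq h.ne' hrange).2, ← area_mul_sum_sq_sub_circumradius_sq h]
    rfl

theorem voronoiVertexSet_vertexSet (h : 0 < crossAt v w u) :
    voronoiVertexSet (vertexSet (v, w, u))
      = edgeTerm v w u + edgeTerm w u v + edgeTerm u v w := by
  have hrange := (range_points_mkTriangle h.ne').trans (coe_vertexSet v w u).symm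
  have hex : ∃ T : Affine.Triangle ℝ Plane, range T.points = (vertexSet (v, w, u) : Set Plane) :=
    ⟨_, hrange⟩
  rw [voronoiVertexSet, dif_pos hex, ← voronoiTriangle_mkTriangle h]
  exact voronoiTriangle_eq_of_range_eq _ _ (hex.choose_spec.trans hrange.symm)

theorem voronoi_delaunay (S : Finset Plane) :
    voronoi (delaunay S) = ∑ τ ∈ delaunayTriples S, edgeTerm τ.1 τ.2.1 τ.2.2 := by
  classical
  have hmaps : ∀ τ ∈ delaunayTriples S, vertexSet τ ∈ delaunay S := fun τ hτ =>
    mem_delaunay_iff.mpr ⟨_, _, _, mem_delaunayTriples.mp hτ, coe_vertexSet ..⟩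
  rw [← Finset.sum_fiberwise_of_maps_to hmaps]
  refine Finset.sum_congr rfl fun t ht => ?_
  obtain ⟨v, w, u, htriple, hset⟩ := mem_delaunay_iff.mp ht
  obtain rfl : t = vertexSet (v, w, u) := Finset.coe_inj.mp (hset.trans (coe_vertexSet v w u).symm)
  rw [voronoiVertexSet_vertexSet htriple.crossAt_pos, sum_edgeTerm_with_vertexSet_eq htriple]

end Triangulation

end VoronoiFunctional

end

open MeasureTheory VoronoiFunctional in
/-- Here `N x` is a nearest point of `S` to `x`, and, for `x` outside `conv S`, `NV x` is a nearest
visible vertex of `conv S`; both exist. -/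
theorem mainTheorem2 (S : Finset Plane) (hne : S.Nonempty) (hgen : GeneralPosition S) :
    (∀ x, ∃ p, IsNearest (S : Set Plane) x p) ∧
    (∀ x, x ∉ hull S → ∃ p, IsNearest (visibleVertices S x) x p) ∧
    ∀ N NV : Plane → Plane,
      (∀ x, IsNearest (S : Set Plane) x (N x)) →
      (∀ x, x ∉ hull S → IsNearest (visibleVertices S x) x (NV x)) →
        Integrable (cellIntegrand S N NV) volume ∧
        voronoi (delaunay S) = ∫ x, cellIntegrand S N NV x ∧
        (HullOppositeAnglesAcute S →
          voronoi (delaunay S) = ∫ x in hull S, dist x (N x) ^ 2) := by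
  refine ⟨exists_isNearest hne, fun x hx => exists_isNearest_visible hne hx, fun N NV hN hNV => ?_⟩
  have hV : voronoi (delaunay S) = ∫ x, cellIntegrand S N NV x := by
    rw [voronoi_delaunay, integral_cellIntegrand_eq_sum_edgeTerm hne hgen hN hNV]
  exact ⟨integrable_cellIntegrand hne hgen hN hNV, hV, fun hacute =>
    hV.trans (integral_cellIntegrand_of_acute hne hacute hN hNV)⟩
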